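/- Let $s\ge 1$ be a fixed integer. For integers $n,m$ and a probability distribution $P$ on $\{0,1,\dots,m\}$, the active random intersection graph $G_s(n,m,P)$ has vertices $v_1,\dots,v_n$, which are assigned independent random subsets $D_1,\dots,D_n$ of $W=\{w_1,\dots,w_m\}$ with $\mathbf P(D_i=A)=\binom{m}{|A|}^{-1}P(|A|)$ for every $A\subset W$; distinct vertices $v_i,v_j$ are adjacent ($v_i\sim v_j$) if $|D_i\cap D_j|\ge s$. Let $d(v)$ be the degree of $v$, let $(v_1^*,v_2^*)$ be an ordered pair of distinct vertices chosen uniformly at random and independently of the graph, and let $\mathbf E^*$ denote expectation (over the graph and the pair) conditional on $v_1^*\sim v_2^*$. The assortativity coefficient is $$r=\frac{g-b^2}{b'-b^2},\qquad g=\mathbf E^*d(v_1^*)d(v_2^*),\quad b=\mathbf E^*d(v_1^*),\quad b'=\mathbf E^*d(v_1^*)^2 .$$ Consider a sequence $G_s(n,m,P)$ with $m=m_n\to\infty$ and $P=P_n$ as $n\to\infty$, and assume $\binom{m}{s}/n\to\beta\in(0,\infty)$. Put $X_1=|D_1|$, $a_k=a_k(n)=\mathbf E\binom{X_1}{s}^k$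 and $Z_1=\binom ms^{-1/2}n^{1/2}\binom{X_1}{s}$. Assume (i) $Z_1$ converges in distribution, as $n\to\infty$, to a real random variable $Z$; and, for an integer $k\ge1$, consider the condition (ii-$k$) $0<\mathbf E Z^k<\infty$ and $\lim_{n\to\infty}\mathbf E Z_1^k=\mathbf E Z^k$. When $z_1=\mathbf E Z<\infty$, let the asymptotic degree $d_*$ be a random variable with $\mathbf P(d_*=k)=\frac1{k!}\mathbf E\big((z_1Z)^ke^{-z_1Z}\big)$, $k=0,1,\dots$, and let $\overline\delta_i=\mathbf E\,d_*(d_*-1)\cdots(d_*-i+1)$ be its factorial moments. If (ii-3) holds, then for all sufficiently large $n$ the coefficient $r$ is well defined (adjacency has positive probability and $b'-b^2>0$), $\overline\delta_1,\overline\delta_2,\overline\delta_3$ are finite, and, as $n\to\infty$, $$r=\frac{a_1}{\beta^{-1}(a_1a_3-a_2^2)+a_2}+o(1)=\frac1{\sqrt\beta}\,\frac{\overline\delta_1^{5/2}}{\overline\delta_3\overline\delta_1-\overline\delta_2^2+\overline\delta_2\overline\delta_1}+o(1).$$ If (ii-2) holds and $\mathbf E Z^3=\infty$, then $r$ is well defined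 for all sufficiently large $n$ and $r=o(1)$ as $n\to\infty$. -/

import Mathlib

open MeasureTheory Filter Topology
open scoped ENNReal

/-! ### Averages over pairs of vertices of a random graph

`(Ω, μ)` is a probability space, `G` a random graph on the finite vertex set `V`, and
`(v₁*, v₂*)` is a uniformly random ordered pair of distinct vertices, independent of `G`. -/

section PairAverages

variable {Ω V : Type*} [MeasurableSpace Ω] [Fintype V] [DecidableEq V]

/-- `E f(v₁*, v₂*)`: the expectation over the random instance and over the random pair. -/
noncomputable def pairExp (μ : Measure Ω) (f : Ω → V → V → ℝ) : ℝ :=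
  ((Fintype.card V : ℝ) * ((Fintype.card V : ℝ) - 1))⁻¹ *
    ∑ p ∈ (Finset.univ : Finset V).offDiag, ∫ ω, f ω p.1 p.2 ∂μ

open Classical in
/-- The indicator of `u ∼ v`. -/
noncomputable def adjInd (G : SimpleGraph V) (u v : V) : ℝ := if G.Adj u v then 1 else 0

open Classical in
/-- The degree `d(v)`, as a real number. -/
noncomputable def deg (G : SimpleGraph V) (v : V) : ℝ := (G.degree v : ℝ)

/-- The edge probability `p_{e*} = P(v₁* ∼ v₂*)`. -/
noncomputable def edgeProb (μ : Measure Ω) (G : Ω → SimpleGraph V) : ℝ :=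
  pairExp μ fun ω u v => adjInd (G ω) u v

/-- `E* f(v₁*, v₂*)`: the conditional expectation given `v₁* ∼ v₂*`. -/
noncomputable def adjExp (μ : Measure Ω) (G : Ω → SimpleGraph V) (f : Ω → V → V → ℝ) : ℝ :=
  (edgeProb μ G)⁻¹ * pairExp μ fun ω u v => f ω u v * adjInd (G ω) u v

/-- `g = E* d(v₁*) d(v₂*)`. -/
noncomputable def degProdMean (μ : Measure Ω) (G : Ω → SimpleGraph V) : ℝ :=
  adjExp μ G fun ω u v => deg (G ω) u * deg (G ω) v

/-- `b = E* d(v₁*)`. -/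
noncomputable def degMean (μ : Measure Ω) (G : Ω → SimpleGraph V) : ℝ :=
  adjExp μ G fun ω u _ => deg (G ω) u

/-- `b' = E* d(v₁*)²`. -/
noncomputable def degSqMean (μ : Measure Ω) (G : Ω → SimpleGraph V) : ℝ :=
  adjExp μ G fun ω u _ => deg (G ω) u ^ 2

/-- The assortativity coefficient `r = (g - b²) / (b' - b²)`. -/
noncomputable def assortativity (μ : Measure Ω) (G : Ω → SimpleGraph V) : ℝ :=
  (degProdMean μ G - degMean μ G ^ 2) / (degSqMean μ G - degMean μ G ^ 2)

end PairAverages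

/-! ### The active random intersection graph `G_s(n, m, P)` -/

/-- The size of a set of attributes, as an element of `{0, …, m}`. -/
def sizeOf' {m : ℕ} (A : Finset (Fin m)) : Fin (m + 1) :=
  ⟨A.card, Nat.lt_succ_of_le (by simpa using A.card_le_univ)⟩

theorem attributePMF_sum {m : ℕ} (P : PMF (Fin (m + 1))) :
    ∑ A : Finset (Fin m), ((m.choose A.card : ℕ) : ℝ≥0∞)⁻¹ * P (sizeOf' A) = 1 := by
  classical
  rw [← Finset.sum_fiberwise (s := Finset.univ) (g := fun A : Finset (Fin m) => sizeOf' A)]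
  rw [← P.tsum_coe, tsum_fintype]
  refine Finset.sum_congr rfl fun k _ => ?_
  have hset : (Finset.univ.filter fun A : Finset (Fin m) => sizeOf' A = k)
      = Finset.powersetCard (k : ℕ) Finset.univ := by
    ext A
    simp [sizeOf', Finset.mem_powersetCard, Fin.ext_iff]
  have hc : ∀ A ∈ Finset.univ.filter fun A : Finset (Fin m) => sizeOf' A = k,
      ((m.choose A.card : ℕ) : ℝ≥0∞)⁻¹ * P (sizeOf' A)
        = ((m.choose k : ℕ) : ℝ≥0∞)⁻¹ * P k := by
    intro A hA
    have h : sizeOf' A = k := by simpa using hA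
    have h' : A.card = (k : ℕ) := congrArg Fin.val h
    rw [h, h']
  rw [Finset.sum_congr rfl hc, Finset.sum_const, hset, Finset.card_powersetCard,
    Finset.card_univ, Fintype.card_fin, nsmul_eq_mul, ← mul_assoc, ENNReal.mul_inv_cancel, one_mul]
  · exact_mod_cast (Nat.choose_pos (Nat.lt_succ_iff.mp k.2)).ne'
  · exact ENNReal.natCast_ne_top _

/-- The law of a random attribute set `D`: `P(D = A) = P(|A|) / binom(m, |A|)` for every
`A ⊆ W = Fin m`. -/
noncomputable def attributePMF {m : ℕ} (P : PMF (Fin (m + 1))) : PMF (Finset (Fin m)) :=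
  PMF.ofFintype (fun A => ((m.choose A.card : ℕ) : ℝ≥0∞)⁻¹ * P (sizeOf' A)) (attributePMF_sum P)

/-- The law of the attribute set of a single vertex, as a measure. -/
noncomputable def attributeLaw {m : ℕ} (P : PMF (Fin (m + 1))) : Measure (Finset (Fin m)) :=
  (attributePMF P).toMeasure

instance {m : ℕ} (P : PMF (Fin (m + 1))) : IsProbabilityMeasure (attributeLaw P) :=
  inferInstanceAs (IsProbabilityMeasure (attributePMF P).toMeasure)

/-- The joint law of the independent attribute sets `D₁, …, D_n`. -/
noncomputable def graphLaw (n : ℕ) {m : ℕ} (P : PMF (Fin (m + 1))) :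
    Measure (Fin n → Finset (Fin m)) :=
  Measure.pi fun _ => attributeLaw P

/-- The intersection graph: distinct vertices are adjacent if they share at least `s`
attributes. -/
def intersectionGraph (s : ℕ) {n m : ℕ} (D : Fin n → Finset (Fin m)) : SimpleGraph (Fin n) where
  Adj i j := i ≠ j ∧ s ≤ (D i ∩ D j).card
  symm := ⟨fun i j h => ⟨h.1.symm, by rw [Finset.inter_comm]; exact h.2⟩⟩
  loopless := ⟨fun _ h => h.1 rfl⟩

/-- The assortativity coefficient `r` of `G_s(n, m, P)`. -/
noncomputable def rCoeff (s n : ℕ) {m : ℕ} (P : PMF (Fin (m + 1))) : ℝ :=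
  assortativity (graphLaw n P) (intersectionGraph s)

/-- `a_k = E binom(X₁, s)^k`, where `X₁ = |D₁|`. -/
noncomputable def jointMoment (s k : ℕ) {m : ℕ} (P : PMF (Fin (m + 1))) : ℝ :=
  ∫ A, (A.card.choose s : ℝ) ^ k ∂(attributeLaw P)

/-- The rescaled number of joints `Z₁ = binom(m, s)^{-1/2} n^{1/2} binom(X₁, s)`. -/
noncomputable def rescaledJoints (s n : ℕ) {m : ℕ} (A : Finset (Fin m)) : ℝ :=
  (√(m.choose s : ℝ))⁻¹ * √(n : ℝ) * (A.card.choose s : ℝ)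

/-! ### Conditions and the asymptotic degree -/

section Limit

variable {Ω : Type*} [MeasurableSpace Ω]

/-- The condition (i): `Z₁` (whose law depends on `n`) converges in distribution to `Z`. -/
def ConditionI (s : ℕ) {m : ℕ → ℕ} (P : ∀ n, PMF (Fin (m n + 1)))
    (ν : Measure Ω) [IsProbabilityMeasure ν] (Z : Ω → ℝ) : Prop :=
  TendstoInDistribution (fun n => rescaledJoints (m := m n) s n) atTop Z
    (fun n => attributeLaw (P n)) ν

/-- The condition (ii-k): `0 < E Z^k < ∞` and `E Z₁^k → E Z^k`. -/
def ConditionII (k s : ℕ) {m : ℕ → ℕ} (P : ∀ n, PMF (Fin (m n + 1)))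
    (ν : Measure Ω) (Z : Ω → ℝ) : Prop :=
  Integrable (fun ω => Z ω ^ k) ν ∧ 0 < ∫ ω, Z ω ^ k ∂ν ∧
    Tendsto (fun n => ∫ A, rescaledJoints s n A ^ k ∂(attributeLaw (P n))) atTop
      (𝓝 (∫ ω, Z ω ^ k ∂ν))

/-- `p_k = E((z₁ Z)^k exp(-z₁ Z)) / k!` with `z₁ = E Z`: the law of the asymptotic degree `d_*`,
which is Poisson with random parameter `z₁ Z`. -/
noncomputable def asympDegreeProb (ν : Measure Ω) (Z : Ω → ℝ) (k : ℕ) : ℝ :=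
  (k.factorial : ℝ)⁻¹ *
    ∫ ω, ((∫ ω', Z ω' ∂ν) * Z ω) ^ k * Real.exp (-((∫ ω', Z ω' ∂ν) * Z ω)) ∂ν

/-- The factorial moment `E (d_*)_i = ∑ₖ k (k - 1) ⋯ (k - i + 1) p_k` of the asymptotic degree. -/
noncomputable def factMoment (ν : Measure Ω) (Z : Ω → ℝ) (i : ℕ) : ℝ :=
  ∑' k : ℕ, (k.descFactorial i : ℝ) * asympDegreeProb ν Z k

/-- The `i`-th factorial moment of the asymptotic degree is finite. -/
def FactMomentFinite (ν : Measure Ω) (Z : Ω → ℝ) (i : ℕ) : Prop :=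
  Summable fun k : ℕ => (k.descFactorial i : ℝ) * asympDegreeProb ν Z k

end Limit

/-!
Write `Y = binom(X, s)` for the number of `s`-subsets ("joints") of an attribute set, `a_k = E Yᵏ`
and `M = binom(m, s)`. Since an attribute set is uniform given its size, two independent sets share
on average `Y₁ Y₂ / M` joints (`integral_integral_choose_inter`), so `Y₁ Y₂ / M` bounds the
conditional probability of an edge from above, and the error (`jointDefect`) vanishes unless the
overlap exceeds `s`. For bounded sizes that costs a further factor `1 / m`; large sizes are
discarded by uniform integrability (`defectMoment_le`, `tendsto_defectMoment`).

Independence of the attribute sets reduces the conditional degree moments `b`, `b'`, `g` to the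
probabilities of stars, of the path with three edges and of the triangle (`degMean_eq`,
`degSqMean_eq`, `degProdMean_eq`). With `a₁ → x`, `a₂ → y`, `a₃ → z`, these satisfy
`M P(edge) → x²`, `M² P(2-star) → x² y`, `M³ P(3-star) → x³ z`, `M³ P(path) → x² y²` and
`M² P(triangle) → x³`. The triangle limit is due to triangles whose three sets have a common
joint: in any other triangle the third set meets the union of the first two in more than `s`
attributes (`triangle_pointwise_le`).

As `M / n → β`, it follows that `b → 1 + y / β`, that `b' → 1 + 3 y / β + x z / β²` and that
`g → 1 + 2 y / β + x / β + y² / β²`. The contributions of the path and the edges to `g - b²` cancel,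
so `g - b² → x / β` comes from the triangles alone, while
`b' - b² → (y + (x z - y²) / β) / β` is positive by the Cauchy-Schwarz inequality. If the third
moment of `Z` is infinite, truncation gives `M³ P(3-star) → ∞`, hence `b' → ∞` while `g` and `b`
stay bounded. Finally the hypotheses on `Z₁` yield `a_k → β^(k/2) E Zᵏ` together with the uniform
integrability (`tendsto_jointMoment`, `uniformTail_of_conditionII`), and the factorial moments of
the mixed Poisson variable `d_*` are `E (z₁ Z)ⁱ` (`factMoment_eq`).
-/

/-! ### The attribute set of a single vertex -/

/-- The weight that the law of an attribute set gives to a set depends only on its size. -/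
theorem exists_integral_attributeLaw_eq_sum {m : ℕ} (P : PMF (Fin (m + 1))) :
    ∃ w : ℕ → ℝ, ∀ f : Finset (Fin m) → ℝ,
      ∫ A, f A ∂(attributeLaw P) = ∑ A, w A.card * f A := by
  refine ⟨fun k => ((m.choose k : ℕ) : ℝ)⁻¹ * (P (Fin.ofNat (m + 1) k)).toReal, fun f => ?_⟩
  rw [attributeLaw, PMF.integral_eq_sum]
  refine Finset.sum_congr rfl fun A _ => ?_
  have h : sizeOf' A = Fin.ofNat (m + 1) A.card := by
    apply Fin.ext
    simp only [sizeOf', Fin.ofNat]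
    exact (Nat.mod_eq_of_lt (Nat.lt_succ_of_le (by simpa using A.card_le_univ))).symm
  simp [attributePMF, PMF.ofFintype_apply, h, ENNReal.toReal_mul, ENNReal.toReal_inv]

/-- The supersets of `S` are the sets `S ∪ T` with `T` disjoint from `S`. -/
theorem sum_superset_apply_card {m : ℕ} (S : Finset (Fin m)) (g : ℕ → ℝ) :
    ∑ A with S ⊆ A, g A.card
      = ∑ k ∈ Finset.range (m - S.card + 1), (m - S.card).choose k • g (S.card + k) := by
  have h := Finset.sum_powerset_apply_card (fun k => g (S.card + k)) (x := Sᶜ)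
  rw [Finset.card_compl, Fintype.card_fin] at h
  rw [← h]
  refine Finset.sum_nbij' (fun A => A \ S) (fun T => S ∪ T) ?_ ?_ ?_ ?_ ?_
  · intro A _
    simp only [Finset.mem_powerset]
    intro x hx
    simp at hx ⊢
    exact hx.2
  · intro T _
    simp
  · intro A hA
    simp at hA
    exact Finset.union_sdiff_of_subset hA
  · intro T hT
    have hd : Disjoint T S := by
      rw [Finset.mem_powerset] at hT
      exact Finset.disjoint_left.2 fun x hx hs => by simpa [hs] using hT hx
    simp only [Finset.union_sdiff_left]
    exact Finset.sdiff_eq_self_of_disjoint hd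
  · intro A hA
    simp at hA
    rw [Finset.card_sdiff_of_subset hA, Nat.add_sub_cancel' (Finset.card_le_card hA)]

theorem sum_mul_choose_card_inter {m : ℕ} (g : ℕ → ℝ) (B : Finset (Fin m)) (t : ℕ) :
    ∑ A, g A.card * ((B ∩ A).card.choose t : ℝ)
      = (B.card.choose t : ℝ) *
        ∑ k ∈ Finset.range (m - t + 1), (m - t).choose k • g (t + k) := by
  have h1 : ∀ A : Finset (Fin m), g A.card * ((B ∩ A).card.choose t : ℝ)
      = ∑ S ∈ B.powersetCard t, if S ⊆ A then g A.card else 0 := by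
    intro A
    rw [← Finset.sum_filter, Finset.sum_const, nsmul_eq_mul, mul_comm]
    congr 2
    rw [← Finset.card_powersetCard]
    congr 1
    ext S
    simp only [Finset.mem_powersetCard, Finset.mem_filter, Finset.subset_inter_iff]
    tauto
  simp_rw [h1]
  rw [Finset.sum_comm, ← Finset.card_powersetCard, ← nsmul_eq_mul, ← Finset.sum_const]
  refine Finset.sum_congr rfl fun S hS => ?_
  rw [← Finset.sum_filter, sum_superset_apply_card, (Finset.mem_powersetCard.1 hS).2]

/-- A uniformly spread set `A` contains each given `t`-set with the same probability, whatever
the weighting `f` of its size; summing over the `t`-subsets of `B` gives this identity. -/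
theorem integral_card_mul_choose_inter {m : ℕ} (P : PMF (Fin (m + 1))) (f : ℕ → ℝ)
    (B : Finset (Fin m)) (t : ℕ) :
    ∫ A, f A.card * ((B ∩ A).card.choose t : ℝ) ∂(attributeLaw P)
      = (B.card.choose t : ℝ) *
        ((∫ A, f A.card * (A.card.choose t : ℝ) ∂(attributeLaw P)) / (m.choose t : ℝ)) := by
  obtain ⟨w, hw⟩ := exists_integral_attributeLaw_eq_sum P
  rw [hw, hw]
  have h1 := sum_mul_choose_card_inter (fun k => w k * f k) B t
  have h2 := sum_mul_choose_card_inter (fun k => w k * f k) (Finset.univ : Finset (Fin m)) t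
  simp only [Finset.univ_inter, Finset.card_univ, Fintype.card_fin, mul_assoc] at h1 h2
  rw [h1, h2]
  by_cases hm : m.choose t = 0
  · have hB : B.card.choose t = 0 := by
      rw [Nat.choose_eq_zero_iff] at hm ⊢
      exact lt_of_le_of_lt (by simpa using B.card_le_univ) hm
    simp [hB]
  · rw [mul_div_cancel_left₀]
    exact_mod_cast hm

/-- The same identity for two independent attribute sets. -/
theorem integral_integral_choose_inter {m : ℕ} (P : PMF (Fin (m + 1))) (f g : ℕ → ℝ) (t : ℕ) :
    ∫ A, ∫ B, f A.card * g B.card * ((A ∩ B).card.choose t : ℝ)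
        ∂(attributeLaw P) ∂(attributeLaw P)
      = (∫ A, f A.card * (A.card.choose t : ℝ) ∂(attributeLaw P)) *
        (∫ A, g A.card * (A.card.choose t : ℝ) ∂(attributeLaw P)) / (m.choose t : ℝ) := by
  simp_rw [mul_assoc, integral_const_mul, integral_card_mul_choose_inter, ← mul_assoc]
  rw [integral_mul_const, mul_div_assoc]

/-! ### From the random graph to independent attribute sets -/

section GraphLaw

variable {m : ℕ} (P : PMF (Fin (m + 1)))

instance (n : ℕ) : IsProbabilityMeasure (graphLaw n P) :=
  inferInstanceAs (IsProbabilityMeasure (Measure.pi fun _ => attributeLaw P))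

/-- A family of distinct vertices carries independent attribute sets with the same law. -/
theorem integral_graphLaw_comp {n r : ℕ} (e : Fin r → Fin n) (he : Function.Injective e)
    (F : (Fin r → Finset (Fin m)) → ℝ) :
    ∫ D, F (fun a => D (e a)) ∂(graphLaw n P) = ∫ D, F D ∂(graphLaw r P) := by
  have h0 : ProbabilityTheory.iIndepFun (fun (i : Fin n) (D : Fin n → Finset (Fin m)) => D i)
      (graphLaw n P) :=
    ProbabilityTheory.iIndepFun_pi (μ := fun _ : Fin n => attributeLaw P)
      (X := fun _ A => A) (fun _ => aemeasurable_id)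
  have h1 := h0.precomp he
  rw [ProbabilityTheory.iIndepFun_iff_map_fun_eq_pi_map
    (fun i => (measurable_pi_apply (e i)).aemeasurable)] at h1
  have h2 : ∀ i : Fin n, Measure.map (fun D : Fin n → Finset (Fin m) => D i) (graphLaw n P)
      = attributeLaw P := fun i =>
    (measurePreserving_eval (fun _ : Fin n => attributeLaw P) i).map_eq
  simp_rw [h2] at h1
  have h3 : graphLaw r P
      = Measure.map (fun (D : Fin n → Finset (Fin m)) a => D (e a)) (graphLaw n P) := h1.symm
  rw [h3, integral_map]
  · exact (measurable_pi_iff.2 fun a => measurable_pi_apply _).aemeasurable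
  · exact (measurable_of_finite _).aestronglyMeasurable

theorem integral_graphLaw_succ (r : ℕ) (F : (Fin (r + 1) → Finset (Fin m)) → ℝ) :
    ∫ D, F D ∂(graphLaw (r + 1) P)
      = ∫ A, ∫ D, F (Fin.cons A D) ∂(graphLaw r P) ∂(attributeLaw P) := by
  have h := (measurePreserving_piFinSuccAbove (fun _ : Fin (r + 1) => attributeLaw P) 0).symm
  have h' := h.integral_comp' F
  rw [graphLaw, ← h', integral_prod]
  · simp only [MeasurableEquiv.piFinSuccAbove, Fin.insertNthEquiv, MeasurableEquiv.symm_mk,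
      MeasurableEquiv.coe_mk, Equiv.symm_symm, Equiv.coe_fn_mk, Fin.insertNth_zero]
    rfl
  · exact .of_finite

theorem integral_graphLaw_zero (F : (Fin 0 → Finset (Fin m)) → ℝ) :
    ∫ D, F D ∂(graphLaw 0 P) = F Fin.elim0 := by
  have : ∀ D, F D = F Fin.elim0 := fun D => congrArg F (Subsingleton.elim _ _)
  simp_rw [this]
  simp

theorem integral_graphLaw_two {n : ℕ} {i j : Fin n} (hij : i ≠ j)
    (F : Finset (Fin m) → Finset (Fin m) → ℝ) :
    ∫ D, F (D i) (D j) ∂(graphLaw n P) = ∫ A, ∫ B, F A B ∂(attributeLaw P) ∂(attributeLaw P) := by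
  have he : Function.Injective ![i, j] := by
    intro a b
    fin_cases a <;> fin_cases b <;> simp [hij, hij.symm]
  have h := integral_graphLaw_comp P ![i, j] he (fun D => F (D 0) (D 1))
  simp only [integral_graphLaw_succ, integral_graphLaw_zero] at h
  exact h

theorem integral_graphLaw_three {n : ℕ} {i j k : Fin n} (hij : i ≠ j) (hik : i ≠ k) (hjk : j ≠ k)
    (F : Finset (Fin m) → Finset (Fin m) → Finset (Fin m) → ℝ) :
    ∫ D, F (D i) (D j) (D k) ∂(graphLaw n P)
      = ∫ A, ∫ B, ∫ C, F A B C ∂(attributeLaw P) ∂(attributeLaw P) ∂(attributeLaw P) := by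
  have he : Function.Injective ![i, j, k] := by
    intro a b
    fin_cases a <;> fin_cases b <;> simp [hij, hij.symm, hik, hik.symm, hjk, hjk.symm]
  have h := integral_graphLaw_comp P ![i, j, k] he (fun D => F (D 0) (D 1) (D 2))
  simp only [integral_graphLaw_succ, integral_graphLaw_zero] at h
  exact h

theorem integral_graphLaw_four {n : ℕ} {i j k l : Fin n} (hij : i ≠ j) (hik : i ≠ k)
    (hil : i ≠ l) (hjk : j ≠ k) (hjl : j ≠ l) (hkl : k ≠ l)
    (F : Finset (Fin m) → Finset (Fin m) → Finset (Fin m) → Finset (Fin m) → ℝ) :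
    ∫ D, F (D i) (D j) (D k) (D l) ∂(graphLaw n P)
      = ∫ A, ∫ B, ∫ C, ∫ E, F A B C E
        ∂(attributeLaw P) ∂(attributeLaw P) ∂(attributeLaw P) ∂(attributeLaw P) := by
  have he : Function.Injective ![i, j, k, l] := by
    intro a b
    fin_cases a <;> fin_cases b <;>
      simp [hij, hij.symm, hik, hik.symm, hjk, hjk.symm, hil, hil.symm, hjl, hjl.symm,
        hkl, hkl.symm]
  have h := integral_graphLaw_comp P ![i, j, k, l] he (fun D => F (D 0) (D 1) (D 2) (D 3))
  simp only [integral_graphLaw_succ, integral_graphLaw_zero] at h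
  exact h

end GraphLaw

/-! ### Subgraph densities and the moments of the degrees -/

/-- The indicator that two attribute sets share at least `s` attributes. -/
noncomputable def meetInd {m : ℕ} (s : ℕ) (A B : Finset (Fin m)) : ℝ :=
  if s ≤ (A ∩ B).card then 1 else 0

section Densities

variable {m : ℕ} (s : ℕ) (P : PMF (Fin (m + 1)))

/-- The probability that a fresh vertex is adjacent to a vertex with attribute set `A`. -/
noncomputable def linkProb (A : Finset (Fin m)) : ℝ := ∫ B, meetInd s A B ∂(attributeLaw P)

/-- The probability that a given star with `k` edges is present: given the attribute set of the
centre, the edges are independent. -/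
noncomputable def starProb (k : ℕ) : ℝ := ∫ A, linkProb s P A ^ k ∂(attributeLaw P)

/-- The probability that a given path with three edges is present, written as an integral over
the attribute sets of its two inner vertices. -/
noncomputable def pathProb : ℝ :=
  ∫ A, ∫ B, meetInd s A B * (linkProb s P A * linkProb s P B) ∂(attributeLaw P) ∂(attributeLaw P)

/-- The probability that a given triangle is present. -/
noncomputable def triangleProb : ℝ :=
  ∫ A, ∫ B, ∫ C, meetInd s A B * (meetInd s A C * meetInd s B C)
    ∂(attributeLaw P) ∂(attributeLaw P) ∂(attributeLaw P)

variable {s P}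

theorem meetInd_comm (A B : Finset (Fin m)) : meetInd s A B = meetInd s B A := by
  rw [meetInd, meetInd, Finset.inter_comm]

theorem meetInd_mul_self (A B : Finset (Fin m)) :
    meetInd s A B * meetInd s A B = meetInd s A B := by
  unfold meetInd; split_ifs <;> simp

variable (s P)

theorem integral_meetInd_two {n : ℕ} {i j : Fin n} (hij : i ≠ j) :
    ∫ D, meetInd s (D i) (D j) ∂(graphLaw n P) = starProb s P 1 := by
  rw [integral_graphLaw_two P hij (fun A B => meetInd s A B)]
  simp [starProb, linkProb]

theorem integral_meetInd_star_two {n : ℕ} {i j k : Fin n} (hij : i ≠ j) (hik : i ≠ k)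
    (hjk : j ≠ k) :
    ∫ D, meetInd s (D i) (D j) * meetInd s (D i) (D k) ∂(graphLaw n P) = starProb s P 2 := by
  rw [integral_graphLaw_three P hij hik hjk (fun A B C => meetInd s A B * meetInd s A C)]
  simp_rw [integral_const_mul, integral_mul_const]
  simp [starProb, linkProb, sq]

theorem integral_meetInd_triangle {n : ℕ} {i j k : Fin n} (hij : i ≠ j) (hik : i ≠ k)
    (hjk : j ≠ k) :
    ∫ D, meetInd s (D i) (D j) * (meetInd s (D i) (D k) * meetInd s (D j) (D k)) ∂(graphLaw n P)
      = triangleProb s P :=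
  integral_graphLaw_three P hij hik hjk
    (fun A B C => meetInd s A B * (meetInd s A C * meetInd s B C))

theorem integral_meetInd_star_three {n : ℕ} {i j k l : Fin n} (hij : i ≠ j) (hik : i ≠ k)
    (hil : i ≠ l) (hjk : j ≠ k) (hjl : j ≠ l) (hkl : k ≠ l) :
    ∫ D, meetInd s (D i) (D j) * (meetInd s (D i) (D k) * meetInd s (D i) (D l)) ∂(graphLaw n P)
      = starProb s P 3 := by
  rw [integral_graphLaw_four P hij hik hil hjk hjl hkl
    (fun A B C E => meetInd s A B * (meetInd s A C * meetInd s A E))]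
  simp_rw [integral_const_mul, integral_mul_const]
  simp [starProb, linkProb, pow_succ, mul_assoc]

theorem integral_meetInd_path {n : ℕ} {i j k l : Fin n} (hij : i ≠ j) (hik : i ≠ k)
    (hil : i ≠ l) (hjk : j ≠ k) (hjl : j ≠ l) (hkl : k ≠ l) :
    ∫ D, meetInd s (D i) (D j) * (meetInd s (D i) (D k) * meetInd s (D j) (D l)) ∂(graphLaw n P)
      = pathProb s P := by
  rw [integral_graphLaw_four P hij hik hil hjk hjl hkl
    (fun A B C E => meetInd s A B * (meetInd s A C * meetInd s B E))]
  simp_rw [integral_const_mul, integral_mul_const]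
  rfl

theorem adjInd_intersectionGraph {n : ℕ} (D : Fin n → Finset (Fin m)) {i j : Fin n}
    (hij : i ≠ j) : adjInd (intersectionGraph s D) i j = meetInd s (D i) (D j) := by
  simp [adjInd, meetInd, intersectionGraph, hij]

/-- Isolating the link to `j` makes the remaining links independent of `i ∼ j` given `D i`. -/
theorem deg_intersectionGraph {n : ℕ} (D : Fin n → Finset (Fin m)) {i j : Fin n}
    (hij : i ≠ j) : deg (intersectionGraph s D) i
      = meetInd s (D i) (D j) + ∑ k ∈ ({i, j} : Finset (Fin n))ᶜ, meetInd s (D i) (D k) := by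
  classical
  have h : deg (intersectionGraph s D) i = ∑ k, adjInd (intersectionGraph s D) i k := by
    unfold deg adjInd
    rw [Finset.sum_boole, ← SimpleGraph.card_neighborFinset_eq_degree,
      SimpleGraph.neighborFinset_eq_filter]
  rw [h, ← Finset.sum_add_sum_compl {i, j}, Finset.sum_pair hij, adjInd_intersectionGraph s D hij]
  have h0 : adjInd (intersectionGraph s D) i i = 0 := by simp [adjInd]
  rw [h0, zero_add]
  congr 1
  refine Finset.sum_congr rfl fun k hk => adjInd_intersectionGraph s D ?_
  rintro rfl
  simp at hk

theorem card_compl_pair {n : ℕ} {i j : Fin n} (hij : i ≠ j) :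
    ((({i, j} : Finset (Fin n))ᶜ).card : ℝ) = n - 2 := by
  have h2 : 2 ≤ n := by
    have := Finset.card_le_univ ({i, j} : Finset (Fin n))
    rwa [Finset.card_pair hij, Fintype.card_fin] at this
  rw [Finset.card_compl, Finset.card_pair hij, Fintype.card_fin, Nat.cast_sub h2]
  norm_num

theorem pairExp_eq_const {n : ℕ} (hn : 2 ≤ n) (μ : Measure (Fin n → Finset (Fin m)))
    (f : (Fin n → Finset (Fin m)) → Fin n → Fin n → ℝ) (c : ℝ)
    (h : ∀ i j, i ≠ j → ∫ D, f D i j ∂μ = c) : pairExp μ f = c := by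
  unfold pairExp
  rw [Finset.sum_congr rfl (g := fun _ => c) fun p hp => h _ _ (Finset.mem_offDiag.1 hp).2.2]
  rw [Finset.sum_const, Finset.offDiag_card, nsmul_eq_mul, Finset.card_univ, Fintype.card_fin,
    Nat.cast_sub (Nat.le_mul_self n), Nat.cast_mul]
  have : (2 : ℝ) ≤ n := by exact_mod_cast hn
  have h1 : (n : ℝ) ≠ 0 := by linarith
  have h2 : (n : ℝ) - 1 ≠ 0 := by linarith
  field_simp

theorem edgeProb_eq {n : ℕ} (hn : 2 ≤ n) :
    edgeProb (graphLaw n P) (intersectionGraph s) = starProb s P 1 := by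
  refine pairExp_eq_const hn _ _ _ fun i j hij => ?_
  simp_rw [adjInd_intersectionGraph s _ hij]
  exact integral_meetInd_two s P hij

/-- The integral of a double sum over the vertices outside a pair, with the diagonal and
off-diagonal terms constant. -/
theorem integral_sum_sum_compl_pair {n : ℕ} {i j : Fin n} (hij : i ≠ j)
    (f : Fin n → Fin n → (Fin n → Finset (Fin m)) → ℝ) (a b : ℝ)
    (ha : ∀ k, k ≠ i → k ≠ j → ∫ D, f k k D ∂(graphLaw n P) = a)
    (hb : ∀ k l, k ≠ i → k ≠ j → l ≠ i → l ≠ j → k ≠ l → ∫ D, f k l D ∂(graphLaw n P) = b) :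
    ∫ D, ∑ k ∈ ({i, j} : Finset (Fin n))ᶜ, ∑ l ∈ ({i, j} : Finset (Fin n))ᶜ, f k l D
        ∂(graphLaw n P) = (n - 2) * a + (n - 2) * (n - 3) * b := by
  set T := ({i, j} : Finset (Fin n))ᶜ with hT
  have hmem : ∀ k ∈ T, k ≠ i ∧ k ≠ j := by
    intro k hk
    simpa [hT] using hk
  have hcard : (T.card : ℝ) = n - 2 := card_compl_pair hij
  rw [integral_finsetSum _ fun _ _ => .of_finite]
  have h1 : ∀ k ∈ T, ∫ D, ∑ l ∈ T, f k l D ∂(graphLaw n P) = a + (n - 3) * b := by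
    intro k hk
    obtain ⟨hki, hkj⟩ := hmem k hk
    rw [integral_finsetSum _ fun _ _ => .of_finite, ← Finset.add_sum_erase _ _ hk,
      ha k hki hkj,
      Finset.sum_congr rfl (g := fun _ => b) fun l hl => by
        obtain ⟨hlk, hl'⟩ := Finset.mem_erase.1 hl
        exact hb k l hki hkj (hmem l hl').1 (hmem l hl').2 hlk.symm,
      Finset.sum_const, nsmul_eq_mul, Finset.card_erase_of_mem hk,
      Nat.cast_sub (Finset.card_pos.2 ⟨k, hk⟩), hcard]
    push_cast
    ring
  rw [Finset.sum_congr rfl h1, Finset.sum_const, nsmul_eq_mul, hcard]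
  ring

theorem integral_sum_compl_pair {n : ℕ} {i j : Fin n} (hij : i ≠ j)
    (f : Fin n → (Fin n → Finset (Fin m)) → ℝ) (a : ℝ)
    (ha : ∀ k, k ≠ i → k ≠ j → ∫ D, f k D ∂(graphLaw n P) = a) :
    ∫ D, ∑ k ∈ ({i, j} : Finset (Fin n))ᶜ, f k D ∂(graphLaw n P) = (n - 2) * a := by
  rw [integral_finsetSum _ fun _ _ => .of_finite,
    Finset.sum_congr rfl (g := fun _ => a) fun k hk => ?_, Finset.sum_const, nsmul_eq_mul,
    card_compl_pair hij]
  have : k ≠ i ∧ k ≠ j := by simpa using hk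
  exact ha k this.1 this.2

theorem degMean_eq {n : ℕ} (hn : 2 ≤ n) :
    degMean (graphLaw n P) (intersectionGraph s)
      = (starProb s P 1)⁻¹ * (starProb s P 1 + (n - 2) * starProb s P 2) := by
  unfold degMean adjExp
  rw [edgeProb_eq s P hn, pairExp_eq_const hn]
  intro i j hij
  simp_rw [adjInd_intersectionGraph s _ hij, deg_intersectionGraph s _ hij, add_mul,
    meetInd_mul_self, Finset.sum_mul]
  rw [integral_add .of_finite .of_finite, integral_meetInd_two s P hij,
    integral_sum_compl_pair P hij _ (starProb s P 2)]
  intro k hki hkj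
  exact integral_meetInd_star_two s P hki.symm hij hkj

theorem degSqMean_eq {n : ℕ} (hn : 2 ≤ n) :
    degSqMean (graphLaw n P) (intersectionGraph s)
      = (starProb s P 1)⁻¹ * (starProb s P 1 + 3 * (n - 2) * starProb s P 2
        + (n - 2) * (n - 3) * starProb s P 3) := by
  unfold degSqMean adjExp
  rw [edgeProb_eq s P hn, pairExp_eq_const hn]
  intro i j hij
  have hpt : ∀ D : Fin n → Finset (Fin m),
      deg (intersectionGraph s D) i ^ 2 * adjInd (intersectionGraph s D) i j
        = meetInd s (D i) (D j)
          + 2 * ∑ k ∈ ({i, j} : Finset (Fin n))ᶜ, meetInd s (D i) (D k) * meetInd s (D i) (D j)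
          + ∑ k ∈ ({i, j} : Finset (Fin n))ᶜ, ∑ l ∈ ({i, j} : Finset (Fin n))ᶜ,
            meetInd s (D i) (D j) * (meetInd s (D i) (D k) * meetInd s (D i) (D l)) := by
    intro D
    rw [adjInd_intersectionGraph s _ hij, deg_intersectionGraph s _ hij, ← Finset.sum_mul]
    simp_rw [← Finset.mul_sum]
    rw [← Finset.sum_mul]
    have h := meetInd_mul_self (s := s) (D i) (D j)
    generalize meetInd s (D i) (D j) = x at h ⊢
    generalize ∑ k ∈ ({i, j} : Finset (Fin n))ᶜ, meetInd s (D i) (D k) = S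
    linear_combination (x + 1 + 2 * S) * h
  simp_rw [hpt]
  rw [integral_add .of_finite .of_finite, integral_add .of_finite .of_finite, integral_const_mul,
    integral_meetInd_two s P hij, integral_sum_compl_pair P hij _ (starProb s P 2),
    integral_sum_sum_compl_pair P hij _ (starProb s P 2) (starProb s P 3)]
  · ring
  · intro k hki hkj
    simp_rw [meetInd_mul_self]
    exact integral_meetInd_star_two s P hij hki.symm hkj.symm
  · intro k l hki hkj hli hlj hkl
    exact integral_meetInd_star_three s P hij hki.symm hli.symm hkj.symm hlj.symm hkl
  · intro k hki hkj
    exact integral_meetInd_star_two s P hki.symm hij hkj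

theorem degProdMean_eq {n : ℕ} (hn : 2 ≤ n) :
    degProdMean (graphLaw n P) (intersectionGraph s)
      = (starProb s P 1)⁻¹ * (starProb s P 1 + 2 * (n - 2) * starProb s P 2
        + (n - 2) * triangleProb s P + (n - 2) * (n - 3) * pathProb s P) := by
  unfold degProdMean adjExp
  rw [edgeProb_eq s P hn, pairExp_eq_const hn]
  intro i j hij
  have hpt : ∀ D : Fin n → Finset (Fin m),
      deg (intersectionGraph s D) i * deg (intersectionGraph s D) j
          * adjInd (intersectionGraph s D) i j
        = meetInd s (D i) (D j)
          + ∑ k ∈ ({i, j} : Finset (Fin n))ᶜ, meetInd s (D i) (D k) * meetInd s (D i) (D j)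
          + ∑ k ∈ ({i, j} : Finset (Fin n))ᶜ, meetInd s (D j) (D k) * meetInd s (D i) (D j)
          + ∑ k ∈ ({i, j} : Finset (Fin n))ᶜ, ∑ l ∈ ({i, j} : Finset (Fin n))ᶜ,
            meetInd s (D i) (D j) * (meetInd s (D i) (D k) * meetInd s (D j) (D l)) := by
    intro D
    rw [adjInd_intersectionGraph s _ hij, deg_intersectionGraph s _ hij,
      deg_intersectionGraph s _ hij.symm, ← Finset.sum_mul, ← Finset.sum_mul, Finset.pair_comm j i,
      meetInd_comm (D j) (D i)]
    simp_rw [← Finset.mul_sum]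
    rw [← Finset.sum_mul]
    have h := meetInd_mul_self (s := s) (D i) (D j)
    generalize meetInd s (D i) (D j) = x at h ⊢
    generalize ∑ k ∈ ({i, j} : Finset (Fin n))ᶜ, meetInd s (D i) (D k) = S
    generalize ∑ k ∈ ({i, j} : Finset (Fin n))ᶜ, meetInd s (D j) (D k) = T
    linear_combination (x + 1 + S + T) * h
  simp_rw [hpt]
  rw [integral_add .of_finite .of_finite, integral_add .of_finite .of_finite,
    integral_add .of_finite .of_finite,
    integral_meetInd_two s P hij, integral_sum_compl_pair P hij _ (starProb s P 2),
    integral_sum_compl_pair P hij _ (starProb s P 2),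
    integral_sum_sum_compl_pair P hij _ (triangleProb s P) (pathProb s P)]
  · ring
  · intro k hki hkj
    exact integral_meetInd_triangle s P hij hki.symm hkj.symm
  · intro k l hki hkj hli hlj hkl
    exact integral_meetInd_path s P hij hki.symm hli.symm hkj.symm hlj.symm hkl
  · intro k hki hkj
    have := integral_meetInd_star_two s P hkj.symm hij.symm hki
    rw [← this]
    refine integral_congr_ae (.of_forall fun D => ?_)
    simp only [meetInd_comm (s := s) (D i) (D j)]
  · intro k hki hkj
    exact integral_meetInd_star_two s P hki.symm hij hkj

end Densities

/-! ### The defect of the first-moment bound -/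

section Defect

variable {m : ℕ} (s : ℕ) (P : PMF (Fin (m + 1)))

theorem integral_mono_attributeLaw {f g : Finset (Fin m) → ℝ} (h : ∀ A, f A ≤ g A) :
    ∫ A, f A ∂(attributeLaw P) ≤ ∫ A, g A ∂(attributeLaw P) :=
  integral_mono .of_finite .of_finite h

/-- The excess of the number of common `s`-subsets of `A` and `B` over the indicator that there
is one. -/
noncomputable def jointDefect (A B : Finset (Fin m)) : ℝ :=
  ((A ∩ B).card.choose s : ℝ) - meetInd s A B

/-- The weighted mean defect `binom(m, s) E(Y₁ʲ Y₂ˡ defect(D₁, D₂))`, with `Y = binom(X, s)`. -/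
noncomputable def defectMoment (j l : ℕ) : ℝ :=
  (m.choose s : ℝ) * ∫ A, ∫ B, (A.card.choose s : ℝ) ^ j * (B.card.choose s : ℝ) ^ l *
    jointDefect s A B ∂(attributeLaw P) ∂(attributeLaw P)

/-- The defect `binom(m, s) E defect(A, D)` of a fixed set `A`. -/
noncomputable def meanDefect (A : Finset (Fin m)) : ℝ :=
  (m.choose s : ℝ) * ∫ B, jointDefect s A B ∂(attributeLaw P)

/-- The part `E(Yᵏ; Y > K)` of the `k`-th moment of `Y = binom(X, s)`. -/
noncomputable def tailMoment (k K : ℕ) : ℝ :=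
  ∫ A, (if K < A.card.choose s then (A.card.choose s : ℝ) ^ k else 0) ∂(attributeLaw P)

variable {s}

theorem meetInd_nonneg (A B : Finset (Fin m)) : 0 ≤ meetInd s A B := by
  unfold meetInd; split_ifs <;> simp

theorem meetInd_le_one (A B : Finset (Fin m)) : meetInd s A B ≤ 1 := by
  unfold meetInd; split_ifs <;> simp

theorem meetInd_le_choose (A B : Finset (Fin m)) :
    meetInd s A B ≤ ((A ∩ B).card.choose s : ℝ) := by
  unfold meetInd
  split_ifs with h
  · exact_mod_cast Nat.choose_pos h
  · positivity

theorem jointDefect_nonneg (A B : Finset (Fin m)) : 0 ≤ jointDefect s A B :=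
  sub_nonneg.2 (meetInd_le_choose A B)

theorem jointDefect_le_choose (A B : Finset (Fin m)) :
    jointDefect s A B ≤ ((A ∩ B).card.choose s : ℝ) :=
  sub_le_self _ (meetInd_nonneg A B)

/-- A positive defect needs an overlap of more than `s` attributes. -/
theorem jointDefect_le_choose_succ (A B : Finset (Fin m)) :
    jointDefect s A B ≤ (s + 1) * ((A ∩ B).card.choose (s + 1) : ℝ) := by
  have h : ((s : ℝ) + 1) * ((A ∩ B).card.choose (s + 1) : ℝ)
      = ((A ∩ B).card.choose s : ℝ) * (((A ∩ B).card - s : ℕ) : ℝ) := by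
    have := Nat.choose_succ_right_eq (A ∩ B).card s
    rw [mul_comm]
    exact_mod_cast this
  rw [h]
  rcases lt_trichotomy (A ∩ B).card s with hlt | heq | hgt
  · refine (jointDefect_le_choose A B).trans ?_
    simp [Nat.choose_eq_zero_of_lt hlt]
  · simp [jointDefect, meetInd, heq]
  · refine (jointDefect_le_choose A B).trans ?_
    have : (1 : ℝ) ≤ (((A ∩ B).card - s : ℕ) : ℝ) := by
      exact_mod_cast Nat.sub_pos_of_lt hgt
    exact le_mul_of_one_le_right (by positivity) this

theorem sub_le_choose (hs : 0 < s) (x : ℕ) : x - s ≤ x.choose s := by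
  rcases le_or_gt x s with h | h
  · simp [Nat.sub_eq_zero_of_le h]
  · obtain ⟨d, rfl⟩ := Nat.exists_eq_add_of_lt h
    clear h
    have key : ∀ d : ℕ, d ≤ (s + d).choose s := by
      intro d
      induction d with
      | zero => simp
      | succ d ih =>
        have hp : 0 < (s + d).choose (s - 1) := Nat.choose_pos (by omega)
        have := Nat.choose_succ_succ' (s + d) (s - 1)
        rw [Nat.sub_add_cancel hs] at this
        rw [← add_assoc, this]
        omega
    have := key (d + 1)
    rw [← add_assoc] at this
    omega

theorem succ_mul_choose_succ_le (hs : 0 < s) (x : ℕ) :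
    ((s : ℝ) + 1) * (x.choose (s + 1) : ℝ) ≤ (x.choose s : ℝ) * (x.choose s : ℝ) := by
  have h1 := Nat.choose_succ_right_eq x s
  have h2 : x.choose (s + 1) * (s + 1) ≤ x.choose s * x.choose s := by
    rw [h1]; exact Nat.mul_le_mul_left _ (sub_le_choose hs x)
  rw [mul_comm]
  exact_mod_cast h2

theorem jointMoment_nonneg (k : ℕ) : 0 ≤ jointMoment s k P :=
  integral_nonneg fun _ => by positivity

theorem tailMoment_nonneg (k K : ℕ) : 0 ≤ tailMoment s P k K :=
  integral_nonneg fun _ => by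
    dsimp only
    split_ifs <;> positivity

theorem meanDefect_nonneg (A : Finset (Fin m)) : 0 ≤ meanDefect s P A :=
  mul_nonneg (by positivity) (integral_nonneg fun _ => jointDefect_nonneg _ _)

theorem linkProb_nonneg (A : Finset (Fin m)) : 0 ≤ linkProb s P A :=
  integral_nonneg fun _ => meetInd_nonneg _ _

theorem choose_mul_linkProb (hsm : s ≤ m) (A : Finset (Fin m)) :
    (m.choose s : ℝ) * linkProb s P A
      = jointMoment s 1 P * (A.card.choose s : ℝ) - meanDefect s P A := by
  have hM : (m.choose s : ℝ) ≠ 0 := by exact_mod_cast (Nat.choose_pos hsm).ne'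
  have h := integral_card_mul_choose_inter P (fun _ => 1) A s
  simp only [one_mul] at h
  unfold meanDefect jointDefect linkProb
  rw [integral_sub .of_finite .of_finite, h, jointMoment]
  simp only [pow_one]
  field_simp
  ring

theorem choose_mul_linkProb_le (hsm : s ≤ m) (A : Finset (Fin m)) :
    (m.choose s : ℝ) * linkProb s P A ≤ jointMoment s 1 P * (A.card.choose s : ℝ) := by
  rw [choose_mul_linkProb P hsm]
  linarith [meanDefect_nonneg (s := s) P A]

theorem meanDefect_le (hsm : s ≤ m) (A : Finset (Fin m)) :
    meanDefect s P A ≤ jointMoment s 1 P * (A.card.choose s : ℝ) := by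
  have h := choose_mul_linkProb P hsm A
  have : 0 ≤ (m.choose s : ℝ) * linkProb s P A :=
    mul_nonneg (by positivity) (linkProb_nonneg P A)
  linarith

theorem integral_mul_meanDefect (j : ℕ) :
    ∫ A, (A.card.choose s : ℝ) ^ j * meanDefect s P A ∂(attributeLaw P) = defectMoment s P j 0 := by
  simp only [meanDefect, defectMoment, pow_zero, mul_one, integral_const_mul]
  rw [← integral_const_mul]
  refine integral_congr_ae (.of_forall fun A => ?_)
  dsimp only
  ring

theorem defectMoment_nonneg (j l : ℕ) : 0 ≤ defectMoment s P j l :=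
  mul_nonneg (by positivity) (integral_nonneg fun A => integral_nonneg fun B => by
    have := jointDefect_nonneg (s := s) A B
    positivity)

/-- Splitting according to whether `Y₁` or `Y₂` exceeds `K`: beyond `K` the defect is bounded by
the expected number of joints, below `K` by the expected number of larger overlaps. -/
theorem defectMoment_le (hs : 0 < s) (hsm : s < m) (j l K : ℕ) :
    defectMoment s P j l ≤ tailMoment s P (j + 1) K * jointMoment s (l + 1) P
      + jointMoment s (j + 1) P * tailMoment s P (l + 1) K
      + (K : ℝ) ^ 2 * jointMoment s (j + 1) P * jointMoment s (l + 1) P / ((m : ℝ) - s) := by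
  have hM : (0 : ℝ) < m.choose s := by exact_mod_cast Nat.choose_pos hsm.le
  have hM1 : (0 : ℝ) < m.choose (s + 1) := by exact_mod_cast Nat.choose_pos hsm
  have hms : (0 : ℝ) < (m : ℝ) - s := sub_pos.2 (by exact_mod_cast hsm)
  have hMM : ((s : ℝ) + 1) * (m.choose (s + 1) : ℝ) = (m.choose s : ℝ) * ((m : ℝ) - s) := by
    have := Nat.choose_succ_right_eq m s
    rw [← Nat.cast_sub hsm.le, mul_comm]
    exact_mod_cast this
  -- `u` truncates to `Y > K` and `v` to `Y ≤ K`
  set y : ℕ → ℝ := fun x => (x.choose s : ℝ) with hy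
  set u : ℕ → ℕ → ℝ := fun i x => if K < x.choose s then y x ^ i else 0 with hu
  set v : ℕ → ℕ → ℝ := fun i x => if K < x.choose s then 0 else y x ^ i with hv
  have hy0 : ∀ x, 0 ≤ y x := fun x => by positivity
  have hu0 : ∀ i x, 0 ≤ u i x := fun i x => by
    simp only [hu]; split_ifs <;> [exact pow_nonneg (hy0 x) i; exact le_rfl]
  have hv0 : ∀ i x, 0 ≤ v i x := fun i x => by
    simp only [hv]; split_ifs <;> [exact le_rfl; exact pow_nonneg (hy0 x) i]
  have huv : ∀ i x, y x ^ i = u i x + v i x := fun i x => by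
    simp only [hu, hv]; split_ifs <;> simp
  have hvy : ∀ i x, v i x ≤ y x ^ i := fun i x => by
    rw [huv i x]; linarith [hu0 i x]
  have hpt : ∀ A B : Finset (Fin m), y A.card ^ j * y B.card ^ l * jointDefect s A B
      ≤ u j A.card * y B.card ^ l * ((A ∩ B).card.choose s : ℝ)
        + y A.card ^ j * u l B.card * ((A ∩ B).card.choose s : ℝ)
        + (s + 1) * (v j A.card * v l B.card * ((A ∩ B).card.choose (s + 1) : ℝ)) := by
    intro A B
    have d0 := jointDefect_nonneg (s := s) A B
    have d1 := jointDefect_le_choose (s := s) A B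
    have d2 := jointDefect_le_choose_succ (s := s) A B
    have e1 : u j A.card * y B.card ^ l * jointDefect s A B
        ≤ u j A.card * y B.card ^ l * ((A ∩ B).card.choose s : ℝ) :=
      mul_le_mul_of_nonneg_left d1 (mul_nonneg (hu0 _ _) (pow_nonneg (hy0 _) _))
    have e2 : v j A.card * u l B.card * jointDefect s A B
        ≤ y A.card ^ j * u l B.card * ((A ∩ B).card.choose s : ℝ) :=
      mul_le_mul (mul_le_mul_of_nonneg_right (hvy _ _) (hu0 _ _)) d1 d0
        (mul_nonneg (pow_nonneg (hy0 _) _) (hu0 _ _))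
    have e3 : v j A.card * v l B.card * jointDefect s A B
        ≤ v j A.card * v l B.card * ((s + 1) * ((A ∩ B).card.choose (s + 1) : ℝ)) :=
      mul_le_mul_of_nonneg_left d2 (mul_nonneg (hv0 _ _) (hv0 _ _))
    calc y A.card ^ j * y B.card ^ l * jointDefect s A B
        = u j A.card * y B.card ^ l * jointDefect s A B
          + v j A.card * u l B.card * jointDefect s A B
          + v j A.card * v l B.card * jointDefect s A B := by
          rw [huv j A.card, huv l B.card]; ring
      _ ≤ _ := by linarith
  have hint : ∫ A, ∫ B, y A.card ^ j * y B.card ^ l * jointDefect s A B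
        ∂(attributeLaw P) ∂(attributeLaw P)
      ≤ (∫ A, u j A.card * y A.card ∂(attributeLaw P))
          * (∫ A, y A.card ^ l * y A.card ∂(attributeLaw P)) / (m.choose s : ℝ)
        + (∫ A, y A.card ^ j * y A.card ∂(attributeLaw P))
          * (∫ A, u l A.card * y A.card ∂(attributeLaw P)) / (m.choose s : ℝ)
        + (s + 1) * ((∫ A, v j A.card * (A.card.choose (s + 1) : ℝ) ∂(attributeLaw P))
          * (∫ A, v l A.card * (A.card.choose (s + 1) : ℝ) ∂(attributeLaw P))
            / (m.choose (s + 1) : ℝ)) := by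
    refine (integral_mono_attributeLaw P fun A => integral_mono_attributeLaw P (hpt A)).trans ?_
    rw [← integral_integral_choose_inter P (u j) (fun x => y x ^ l) s,
      ← integral_integral_choose_inter P (fun x => y x ^ j) (u l) s,
      ← integral_integral_choose_inter P (v j) (v l) (s + 1), ← integral_const_mul,
      ← integral_add .of_finite .of_finite, ← integral_add .of_finite .of_finite]
    refine le_of_eq (integral_congr_ae (.of_forall fun A => ?_))
    dsimp only
    rw [← integral_const_mul, ← integral_add .of_finite .of_finite,
      ← integral_add .of_finite .of_finite]
  have hyi : ∀ i, ∫ A, y A.card ^ i * y A.card ∂(attributeLaw P) = jointMoment s (i + 1) P := by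
    intro i; simp only [jointMoment, hy, pow_succ]
  have hui : ∀ i, ∫ A, u i A.card * y A.card ∂(attributeLaw P) = tailMoment s P (i + 1) K := by
    intro i
    simp only [tailMoment, hu, hy, ite_mul, zero_mul, ← pow_succ]
  have hvi : ∀ i, (s + 1) * ∫ A, v i A.card * (A.card.choose (s + 1) : ℝ) ∂(attributeLaw P)
      ≤ K * jointMoment s (i + 1) P := by
    intro i
    rw [jointMoment, ← integral_const_mul, ← integral_const_mul]
    refine integral_mono_attributeLaw P fun A => ?_
    have h1 := succ_mul_choose_succ_le hs A.card
    simp only [hv, hy]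
    split_ifs with h
    · simp only [zero_mul, mul_zero]; positivity
    · have h2 : ((A.card.choose s : ℕ) : ℝ) ≤ K := by exact_mod_cast not_lt.1 h
      have h3 : (0 : ℝ) ≤ (A.card.choose s : ℝ) ^ i := by positivity
      calc ((s : ℝ) + 1) * ((A.card.choose s : ℝ) ^ i * (A.card.choose (s + 1) : ℝ))
          = (A.card.choose s : ℝ) ^ i * (((s : ℝ) + 1) * (A.card.choose (s + 1) : ℝ)) := by ring
        _ ≤ (A.card.choose s : ℝ) ^ i * ((A.card.choose s : ℝ) * (A.card.choose s : ℝ)) :=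
          mul_le_mul_of_nonneg_left h1 h3
        _ ≤ (A.card.choose s : ℝ) ^ i * (K * (A.card.choose s : ℝ)) := by gcongr
        _ = _ := by ring
  rw [hyi, hyi, hui, hui] at hint
  have hv0' : ∀ i, 0 ≤ ∫ A, v i A.card * (A.card.choose (s + 1) : ℝ) ∂(attributeLaw P) :=
    fun i => integral_nonneg fun A => mul_nonneg (hv0 _ _) (by positivity)
  set V := fun i => ∫ A, v i A.card * (A.card.choose (s + 1) : ℝ) ∂(attributeLaw P) with hV
  have hVV : ((s : ℝ) + 1) * V j * (((s : ℝ) + 1) * V l)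
      ≤ K * jointMoment s (j + 1) P * (K * jointMoment s (l + 1) P) :=
    mul_le_mul (hvi j) (hvi l) (mul_nonneg (by positivity) (hv0' l))
      (mul_nonneg (by positivity) (jointMoment_nonneg P _))
  have hlast : (m.choose s : ℝ) * ((s + 1) * (V j * V l / (m.choose (s + 1) : ℝ)))
      ≤ (K : ℝ) ^ 2 * jointMoment s (j + 1) P * jointMoment s (l + 1) P / ((m : ℝ) - s) := by
    have : (m.choose s : ℝ) * ((s + 1) * (V j * V l / (m.choose (s + 1) : ℝ)))
        = ((s : ℝ) + 1) * V j * (((s : ℝ) + 1) * V l) / ((m : ℝ) - s) := by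
      rw [eq_div_iff hms.ne']
      field_simp
      linear_combination (-(V j * V l)) * hMM
    rw [this]
    exact div_le_div_of_nonneg_right (hVV.trans_eq (by ring)) hms.le
  calc defectMoment s P j l
      ≤ (m.choose s : ℝ) * (tailMoment s P (j + 1) K * jointMoment s (l + 1) P / (m.choose s : ℝ)
        + jointMoment s (j + 1) P * tailMoment s P (l + 1) K / (m.choose s : ℝ)
        + (s + 1) * (V j * V l / (m.choose (s + 1) : ℝ))) :=
        mul_le_mul_of_nonneg_left hint hM.le
    _ = tailMoment s P (j + 1) K * jointMoment s (l + 1) P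
        + jointMoment s (j + 1) P * tailMoment s P (l + 1) K
        + (m.choose s : ℝ) * ((s + 1) * (V j * V l / (m.choose (s + 1) : ℝ))) := by
        rw [mul_add, mul_add, mul_div_cancel₀ _ hM.ne', mul_div_cancel₀ _ hM.ne']
    _ ≤ _ := by linarith

end Defect

/-! ### Bounds for the subgraph densities -/

section DensityBounds

variable {m : ℕ} {s : ℕ} (P : PMF (Fin (m + 1)))

theorem choose_pow_mul_starProb (k : ℕ) :
    (m.choose s : ℝ) ^ k * starProb s P k
      = ∫ A, ((m.choose s : ℝ) * linkProb s P A) ^ k ∂(attributeLaw P) := by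
  simp_rw [mul_pow]
  rw [integral_const_mul, starProb]

theorem choose_pow_mul_starProb_le (hsm : s ≤ m) (k : ℕ) :
    (m.choose s : ℝ) ^ k * starProb s P k ≤ jointMoment s 1 P ^ k * jointMoment s k P := by
  rw [choose_pow_mul_starProb]
  set a := jointMoment s 1 P with ha
  rw [jointMoment, ← integral_const_mul]
  refine integral_mono_attributeLaw P fun A => ?_
  rw [← mul_pow]
  exact pow_le_pow_left₀ (mul_nonneg (by positivity) (linkProb_nonneg P A))
    (choose_mul_linkProb_le P hsm A) k

/-- Bernoulli's inequality in homogeneous form. -/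
theorem pow_succ_sub_le_sub_pow {u d : ℝ} (hd : 0 ≤ d) (hu : d ≤ u) (k : ℕ) :
    u ^ (k + 1) - (k + 1) * (d * u ^ k) ≤ (u - d) ^ (k + 1) := by
  induction k with
  | zero => simp
  | succ k ih =>
    have hu0 : 0 ≤ u := hd.trans hu
    calc u ^ (k + 1 + 1) - ((k + 1 : ℕ) + 1) * (d * u ^ (k + 1))
        ≤ (u ^ (k + 1) - (k + 1) * (d * u ^ k)) * (u - d) := by
          have : 0 ≤ ((k : ℝ) + 1) * d ^ 2 * u ^ k := by positivity
          push_cast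
          ring_nf at this ⊢
          nlinarith
      _ ≤ (u - d) ^ (k + 1) * (u - d) := mul_le_mul_of_nonneg_right ih (sub_nonneg.2 hu)
      _ = _ := by ring

theorem le_choose_pow_mul_starProb (hsm : s ≤ m) (k : ℕ) :
    jointMoment s 1 P ^ (k + 1) * jointMoment s (k + 1) P
        - (k + 1) * jointMoment s 1 P ^ k * defectMoment s P k 0
      ≤ (m.choose s : ℝ) ^ (k + 1) * starProb s P (k + 1) := by
  rw [choose_pow_mul_starProb, ← integral_mul_meanDefect]
  set a := jointMoment s 1 P with ha
  rw [jointMoment, ← integral_const_mul, ← integral_const_mul, ← integral_sub .of_finite .of_finite]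
  refine integral_mono_attributeLaw P fun A => ?_
  have h := pow_succ_sub_le_sub_pow (meanDefect_nonneg P A) (meanDefect_le P hsm A) k
  rw [choose_mul_linkProb P hsm]
  refine le_trans (le_of_eq ?_) h
  ring

/-- The moments of `min(Y, K)`, where `Y = binom(X, s)`. -/
noncomputable def truncMoment (s : ℕ) {m : ℕ} (P : PMF (Fin (m + 1))) (k K : ℕ) : ℝ :=
  ∫ A, (min (A.card.choose s : ℝ) K) ^ k ∂(attributeLaw P)

/-- A lower bound that needs no third moment of `Y`: cut `Y` off at `K` before expanding the cube. -/
theorem le_choose_pow_mul_starProb_three (hsm : s ≤ m) (K : ℕ) :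
    jointMoment s 1 P ^ 3 * truncMoment s P 3 K
        - 3 * jointMoment s 1 P ^ 2 * K ^ 2 * defectMoment s P 0 0
      ≤ (m.choose s : ℝ) ^ 3 * starProb s P 3 := by
  rw [choose_pow_mul_starProb, ← integral_mul_meanDefect]
  set a := jointMoment s 1 P with ha
  have ha0 : 0 ≤ a := jointMoment_nonneg P 1
  rw [truncMoment, ← integral_const_mul, ← integral_const_mul, ← integral_sub .of_finite .of_finite]
  refine integral_mono_attributeLaw P fun A => ?_
  have hd := meanDefect_nonneg (s := s) P A
  have h1 := choose_mul_linkProb P hsm A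
  have h0 : 0 ≤ (m.choose s : ℝ) * linkProb s P A :=
    mul_nonneg (by positivity) (linkProb_nonneg P A)
  set w := min (A.card.choose s : ℝ) K with hw
  have hw0 : 0 ≤ w := by positivity
  have hwK : w ≤ K := min_le_right _ _
  have hle : a * w - meanDefect s P A ≤ (m.choose s : ℝ) * linkProb s P A := by
    rw [h1]
    have : a * w ≤ a * (A.card.choose s : ℝ) := mul_le_mul_of_nonneg_left (min_le_left _ _) ha0
    linarith
  have hK : meanDefect s P A * (a * w) ^ 2 ≤ meanDefect s P A * (a * K) ^ 2 := by gcongr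
  rcases le_or_gt (meanDefect s P A) (a * w) with hc | hc
  · have h2 := pow_succ_sub_le_sub_pow hd hc 2
    have h3 := pow_le_pow_left₀ (sub_nonneg.2 hc) hle 3
    norm_num at h2
    simp only [pow_zero, one_mul]
    nlinarith
  · have h3 : 0 ≤ ((m.choose s : ℝ) * linkProb s P A) ^ 3 := pow_nonneg h0 3
    have h4 : (a * w) ^ 2 * (a * w) ≤ (a * w) ^ 2 * meanDefect s P A :=
      mul_le_mul_of_nonneg_left hc.le (sq_nonneg _)
    have h5 : 0 ≤ meanDefect s P A * (a * K) ^ 2 := by positivity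
    simp only [pow_zero, one_mul]
    nlinarith

theorem choose_mul_integral_weighted (hsm : s ≤ m) (A : Finset (Fin m)) (l : ℕ) :
    (m.choose s : ℝ) * ∫ B, (B.card.choose s : ℝ) ^ l * ((A ∩ B).card.choose s : ℝ)
        ∂(attributeLaw P) = (A.card.choose s : ℝ) * jointMoment s (l + 1) P := by
  have hM : (m.choose s : ℝ) ≠ 0 := by exact_mod_cast (Nat.choose_pos hsm).ne'
  rw [integral_card_mul_choose_inter P (fun x => (x.choose s : ℝ) ^ l) A s, jointMoment]
  simp only [← pow_succ]
  field_simp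

theorem choose_mul_integral_integral_weighted (hsm : s ≤ m) (j l : ℕ) :
    (m.choose s : ℝ) * ∫ A, ∫ B, (A.card.choose s : ℝ) ^ j * (B.card.choose s : ℝ) ^ l *
        ((A ∩ B).card.choose s : ℝ) ∂(attributeLaw P) ∂(attributeLaw P)
      = jointMoment s (j + 1) P * jointMoment s (l + 1) P := by
  have hM : (m.choose s : ℝ) ≠ 0 := by exact_mod_cast (Nat.choose_pos hsm).ne'
  rw [integral_integral_choose_inter P (fun x => (x.choose s : ℝ) ^ j)
    (fun x => (x.choose s : ℝ) ^ l) s, jointMoment, jointMoment]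
  simp only [← pow_succ]
  field_simp

theorem choose_pow_mul_pathProb :
    (m.choose s : ℝ) ^ 3 * pathProb s P = (m.choose s : ℝ) * ∫ A, ∫ B, meetInd s A B *
        (((m.choose s : ℝ) * linkProb s P A) * ((m.choose s : ℝ) * linkProb s P B))
        ∂(attributeLaw P) ∂(attributeLaw P) := by
  rw [pow_succ', mul_assoc, pathProb]
  simp_rw [← integral_const_mul]
  refine integral_congr_ae (.of_forall fun A => integral_congr_ae (.of_forall fun B => ?_))
  dsimp only
  ring

theorem choose_pow_mul_pathProb_le (hsm : s ≤ m) :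
    (m.choose s : ℝ) ^ 3 * pathProb s P ≤ jointMoment s 1 P ^ 2 * jointMoment s 2 P ^ 2 := by
  have h := choose_mul_integral_integral_weighted P hsm 1 1
  rw [choose_pow_mul_pathProb, show jointMoment s 1 P ^ 2 * jointMoment s 2 P ^ 2
    = jointMoment s 1 P ^ 2 * (jointMoment s (1 + 1) P * jointMoment s (1 + 1) P) by ring, ← h,
    mul_left_comm]
  refine mul_le_mul_of_nonneg_left ?_ (by positivity)
  simp_rw [← integral_const_mul]
  refine integral_mono_attributeLaw P fun A => integral_mono_attributeLaw P fun B => ?_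
  have hA := choose_mul_linkProb_le P hsm A
  have hB := choose_mul_linkProb_le P hsm B
  have hA0 : 0 ≤ (m.choose s : ℝ) * linkProb s P A :=
    mul_nonneg (by positivity) (linkProb_nonneg P A)
  have hB0 : 0 ≤ (m.choose s : ℝ) * linkProb s P B :=
    mul_nonneg (by positivity) (linkProb_nonneg P B)
  have ha := jointMoment_nonneg (s := s) P 1
  refine (mul_le_mul (meetInd_le_choose A B) (mul_le_mul hA hB hB0 (by positivity))
    (mul_nonneg hA0 hB0) (by positivity)).trans (le_of_eq ?_)
  ring

theorem integral_integral_weighted_meanDefect (hsm : s ≤ m) :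
    (m.choose s : ℝ) * ∫ A, ∫ B, ((A ∩ B).card.choose s : ℝ) *
        (meanDefect s P A * (B.card.choose s : ℝ)) ∂(attributeLaw P) ∂(attributeLaw P)
      = jointMoment s 2 P * defectMoment s P 1 0 := by
  rw [← integral_mul_meanDefect, ← integral_const_mul, ← integral_const_mul]
  refine integral_congr_ae (.of_forall fun A => ?_)
  have h := choose_mul_integral_weighted P hsm A 1
  dsimp only
  have h2 : ∫ B, ((A ∩ B).card.choose s : ℝ) * (meanDefect s P A * (B.card.choose s : ℝ))
      ∂(attributeLaw P) = meanDefect s P A * ∫ B, (B.card.choose s : ℝ) ^ 1 *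
        ((A ∩ B).card.choose s : ℝ) ∂(attributeLaw P) := by
    rw [← integral_const_mul]
    refine integral_congr_ae (.of_forall fun B => ?_)
    dsimp only
    ring
  rw [h2, mul_left_comm, h]
  ring

theorem le_choose_pow_mul_pathProb (hsm : s ≤ m) :
    jointMoment s 1 P ^ 2 * jointMoment s 2 P ^ 2 - jointMoment s 1 P ^ 2 * defectMoment s P 1 1
        - 2 * (jointMoment s 1 P * (jointMoment s 2 P * defectMoment s P 1 0))
      ≤ (m.choose s : ℝ) ^ 3 * pathProb s P := by
  have h := choose_mul_integral_integral_weighted P hsm 1 1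
  have h1 := integral_integral_weighted_meanDefect P hsm
  have h2 : (m.choose s : ℝ) * ∫ A, ∫ B, ((A ∩ B).card.choose s : ℝ) *
        (meanDefect s P B * (A.card.choose s : ℝ)) ∂(attributeLaw P) ∂(attributeLaw P)
      = jointMoment s 2 P * defectMoment s P 1 0 := by
    rw [integral_integral_swap .of_finite, ← h1]
    simp_rw [Finset.inter_comm]
  rw [choose_pow_mul_pathProb]
  have ha := jointMoment_nonneg (s := s) P 1
  set a := jointMoment s 1 P with had
  have hpt : ∀ A B : Finset (Fin m),
      a ^ 2 * ((A.card.choose s : ℝ) ^ 1 * (B.card.choose s : ℝ) ^ 1 *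
          ((A ∩ B).card.choose s : ℝ))
        - a ^ 2 * ((A.card.choose s : ℝ) ^ 1 * (B.card.choose s : ℝ) ^ 1 * jointDefect s A B)
        - a * (((A ∩ B).card.choose s : ℝ) * (meanDefect s P A * (B.card.choose s : ℝ)))
        - a * (((A ∩ B).card.choose s : ℝ) * (meanDefect s P B * (A.card.choose s : ℝ)))
      ≤ meetInd s A B *
        (((m.choose s : ℝ) * linkProb s P A) * ((m.choose s : ℝ) * linkProb s P B)) := by
    intro A B
    rw [choose_mul_linkProb P hsm, choose_mul_linkProb P hsm, ← had]
    have e0 := meetInd_nonneg (s := s) A B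
    have dA := meanDefect_nonneg (s := s) P A
    have dB := meanDefect_nonneg (s := s) P B
    have hx : (0 : ℝ) ≤ (A.card.choose s : ℝ) := by positivity
    have hy : (0 : ℝ) ≤ (B.card.choose s : ℝ) := by positivity
    have e1 := mul_le_mul_of_nonneg_right (meetInd_le_choose (s := s) A B)
      (mul_nonneg ha (mul_nonneg dA hy))
    have e2 := mul_le_mul_of_nonneg_right (meetInd_le_choose (s := s) A B)
      (mul_nonneg ha (mul_nonneg dB hx))
    have e3 := mul_nonneg e0 (mul_nonneg dA dB)
    have hg : meetInd s A B = ((A ∩ B).card.choose s : ℝ) - jointDefect s A B := by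
      rw [jointDefect]; ring
    have e4 : meetInd s A B * (a ^ 2 * ((A.card.choose s : ℝ) * (B.card.choose s : ℝ)))
        = (((A ∩ B).card.choose s : ℝ) - jointDefect s A B) *
          (a ^ 2 * ((A.card.choose s : ℝ) * (B.card.choose s : ℝ))) := by rw [hg]
    linarith
  have hmono := mul_le_mul_of_nonneg_left
    (integral_mono_attributeLaw P fun A => integral_mono_attributeLaw P (hpt A))
    (by positivity : (0 : ℝ) ≤ (m.choose s : ℝ))
  refine le_trans (le_of_eq ?_) hmono
  have hsplit : ∫ A, ∫ B, (a ^ 2 * ((A.card.choose s : ℝ) ^ 1 * (B.card.choose s : ℝ) ^ 1 *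
          ((A ∩ B).card.choose s : ℝ))
        - a ^ 2 * ((A.card.choose s : ℝ) ^ 1 * (B.card.choose s : ℝ) ^ 1 * jointDefect s A B)
        - a * (((A ∩ B).card.choose s : ℝ) * (meanDefect s P A * (B.card.choose s : ℝ)))
        - a * (((A ∩ B).card.choose s : ℝ) * (meanDefect s P B * (A.card.choose s : ℝ))))
        ∂(attributeLaw P) ∂(attributeLaw P)
      = a ^ 2 * (∫ A, ∫ B, (A.card.choose s : ℝ) ^ 1 * (B.card.choose s : ℝ) ^ 1 *
          ((A ∩ B).card.choose s : ℝ) ∂(attributeLaw P) ∂(attributeLaw P))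
        - a ^ 2 * (∫ A, ∫ B, (A.card.choose s : ℝ) ^ 1 * (B.card.choose s : ℝ) ^ 1 *
          jointDefect s A B ∂(attributeLaw P) ∂(attributeLaw P))
        - a * (∫ A, ∫ B, ((A ∩ B).card.choose s : ℝ) * (meanDefect s P A * (B.card.choose s : ℝ))
          ∂(attributeLaw P) ∂(attributeLaw P))
        - a * (∫ A, ∫ B, ((A ∩ B).card.choose s : ℝ) * (meanDefect s P B * (A.card.choose s : ℝ))
          ∂(attributeLaw P) ∂(attributeLaw P)) := by
    simp_rw [← integral_const_mul]
    rw [← integral_sub .of_finite .of_finite, ← integral_sub .of_finite .of_finite,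
      ← integral_sub .of_finite .of_finite]
    refine integral_congr_ae (.of_forall fun A => ?_)
    dsimp only
    rw [← integral_sub .of_finite .of_finite, ← integral_sub .of_finite .of_finite,
      ← integral_sub .of_finite .of_finite]
  rw [hsplit, defectMoment]
  linear_combination (-a ^ 2) * h + a * h1 + a * h2

/-- A triangle contains the event that two vertices are adjacent and the third one contains a
fixed `s`-subset of their intersection. -/
theorem le_choose_pow_mul_triangleProb (hsm : s ≤ m) :
    (m.choose s : ℝ) * starProb s P 1 * jointMoment s 1 P
      ≤ (m.choose s : ℝ) ^ 2 * triangleProb s P := by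
  have hM : (m.choose s : ℝ) ≠ 0 := by exact_mod_cast (Nat.choose_pos hsm).ne'
  rw [pow_two, mul_assoc, mul_assoc]
  refine mul_le_mul_of_nonneg_left ?_ (by positivity)
  simp only [starProb, pow_one, linkProb, triangleProb]
  rw [← integral_mul_const, ← integral_const_mul]
  refine integral_mono_attributeLaw P fun A => ?_
  rw [← integral_mul_const, ← integral_const_mul]
  refine integral_mono_attributeLaw P fun B => ?_
  rw [integral_const_mul, mul_left_comm]
  by_cases hAB : s ≤ (A ∩ B).card
  · refine mul_le_mul_of_nonneg_left ?_ (meetInd_nonneg A B)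
    obtain ⟨S, hS, hSc⟩ := Finset.exists_subset_card_eq hAB
    have h := integral_card_mul_choose_inter P (fun _ => 1) S s
    simp only [one_mul, hSc, Nat.choose_self, Nat.cast_one] at h
    have h' : jointMoment s 1 P
        = (m.choose s : ℝ) * ∫ C, ((S ∩ C).card.choose s : ℝ) ∂(attributeLaw P) := by
      rw [h, jointMoment]
      simp only [pow_one]
      field_simp
    rw [h']
    refine mul_le_mul_of_nonneg_left (integral_mono_attributeLaw P fun C => ?_) (by positivity)
    by_cases hSC : S ⊆ C
    · have hA : s ≤ (A ∩ C).card := hSc ▸ Finset.card_le_card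
        (Finset.subset_inter (hS.trans Finset.inter_subset_left) hSC)
      have hB : s ≤ (B ∩ C).card := hSc ▸ Finset.card_le_card
        (Finset.subset_inter (hS.trans Finset.inter_subset_right) hSC)
      simp [meetInd, hA, hB, Finset.inter_eq_left.2 hSC, hSc]
    · have hlt : (S ∩ C).card < s := by
        rw [← hSc]
        refine Finset.card_lt_card (Finset.ssubset_iff_subset_ne.2 ⟨Finset.inter_subset_left, ?_⟩)
        intro he
        exact hSC (Finset.inter_eq_left.1 he)
      rw [Nat.choose_eq_zero_of_lt hlt, Nat.cast_zero]
      exact mul_nonneg (meetInd_nonneg _ _) (meetInd_nonneg _ _)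
  · have : meetInd s A B = 0 := by simp [meetInd, hAB]
    simp [this]

theorem integral_three_swap_left (F : Finset (Fin m) → Finset (Fin m) → Finset (Fin m) → ℝ) :
    ∫ A, ∫ B, ∫ C, F B A C ∂(attributeLaw P) ∂(attributeLaw P) ∂(attributeLaw P)
      = ∫ A, ∫ B, ∫ C, F A B C ∂(attributeLaw P) ∂(attributeLaw P) ∂(attributeLaw P) := by
  rw [← integral_graphLaw_three P (n := 3) (i := 0) (j := 1) (k := 2) (by decide) (by decide)
      (by decide) (fun A B C => F B A C),
    ← integral_graphLaw_three P (n := 3) (i := 1) (j := 0) (k := 2) (by decide) (by decide)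
      (by decide) F]

theorem integral_three_rotate (F : Finset (Fin m) → Finset (Fin m) → Finset (Fin m) → ℝ) :
    ∫ A, ∫ B, ∫ C, F C A B ∂(attributeLaw P) ∂(attributeLaw P) ∂(attributeLaw P)
      = ∫ A, ∫ B, ∫ C, F A B C ∂(attributeLaw P) ∂(attributeLaw P) ∂(attributeLaw P) := by
  rw [← integral_graphLaw_three P (n := 3) (i := 0) (j := 1) (k := 2) (by decide) (by decide)
      (by decide) (fun A B C => F C A B),
    ← integral_graphLaw_three P (n := 3) (i := 2) (j := 0) (k := 1) (by decide) (by decide)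
      (by decide) F]

/-- Two edges at a vertex with more than `K` joints. -/
theorem choose_sq_mul_integral_large_le (hsm : s ≤ m) (K : ℕ) :
    (m.choose s : ℝ) ^ 2 * ∫ A, ∫ B, ∫ C,
        (if K < A.card.choose s then 1 else 0) * (meetInd s A B * meetInd s A C)
        ∂(attributeLaw P) ∂(attributeLaw P) ∂(attributeLaw P)
      ≤ jointMoment s 1 P ^ 2 * tailMoment s P 2 K := by
  simp_rw [integral_const_mul, integral_mul_const]
  rw [← integral_const_mul, tailMoment, ← integral_const_mul]
  refine integral_mono_attributeLaw P fun A => ?_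
  have hA := choose_mul_linkProb_le P hsm A
  have hA0 : 0 ≤ (m.choose s : ℝ) * linkProb s P A :=
    mul_nonneg (by positivity) (linkProb_nonneg P A)
  have h2 := pow_le_pow_left₀ hA0 hA 2
  unfold linkProb at h2
  split_ifs
  · linarith
  · simp

/-- For three attribute sets meeting pairwise in at least `s` elements, either the triple
intersection has at least `s` elements or the third set meets the union of the others in more
than `s` elements. -/
theorem triangle_pointwise_le (hs : 0 < s) (K : ℕ) (A B C : Finset (Fin m)) :
    meetInd s A B * (meetInd s A C * meetInd s B C)
      ≤ (((A ∩ B) ∩ C).card.choose s : ℝ)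
        + (if K < A.card.choose s then 1 else 0) * (meetInd s A B * meetInd s A C)
        + (if K < B.card.choose s then 1 else 0) * (meetInd s B A * meetInd s B C)
        + (if K < C.card.choose s then 1 else 0) * (meetInd s C A * meetInd s C B)
        + ((A ∩ B).card.choose s : ℝ) * ((if (A ∪ B).card ≤ 2 * (K + s) then 1 else 0) *
          ((if K < C.card.choose s then 0 else 1) * (((A ∪ B) ∩ C).card.choose (s + 1) : ℝ))) := by
  have x0 := meetInd_nonneg (s := s) A B
  have y0 := meetInd_nonneg (s := s) A C
  have z0 := meetInd_nonneg (s := s) B C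
  have x1 := meetInd_le_one (s := s) A B
  have y1 := meetInd_le_one (s := s) A C
  have z1 := meetInd_le_one (s := s) B C
  rw [meetInd_comm B A, meetInd_comm C A, meetInd_comm C B]
  have t1 : (0 : ℝ) ≤ (((A ∩ B) ∩ C).card.choose s : ℝ) := by positivity
  have t2 : 0 ≤ (if K < A.card.choose s then (1 : ℝ) else 0) * (meetInd s A B * meetInd s A C) :=
    mul_nonneg (by split_ifs <;> simp) (mul_nonneg x0 y0)
  have t3 : 0 ≤ (if K < B.card.choose s then (1 : ℝ) else 0) * (meetInd s A B * meetInd s B C) :=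
    mul_nonneg (by split_ifs <;> simp) (mul_nonneg x0 z0)
  have t4 : 0 ≤ (if K < C.card.choose s then (1 : ℝ) else 0) * (meetInd s A C * meetInd s B C) :=
    mul_nonneg (by split_ifs <;> simp) (mul_nonneg y0 z0)
  have t5 : 0 ≤ ((A ∩ B).card.choose s : ℝ) *
      ((if (A ∪ B).card ≤ 2 * (K + s) then (1 : ℝ) else 0) *
        ((if K < C.card.choose s then (0 : ℝ) else 1) *
          (((A ∪ B) ∩ C).card.choose (s + 1) : ℝ))) :=
    mul_nonneg (by positivity) (mul_nonneg (by split_ifs <;> simp)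
      (mul_nonneg (by split_ifs <;> simp) (by positivity)))
  by_cases hA : K < A.card.choose s
  · have : meetInd s A B * (meetInd s A C * meetInd s B C)
        ≤ (if K < A.card.choose s then (1 : ℝ) else 0) * (meetInd s A B * meetInd s A C) := by
      rw [if_pos hA, one_mul, ← mul_assoc]
      exact mul_le_of_le_one_right (mul_nonneg x0 y0) z1
    linarith
  by_cases hB : K < B.card.choose s
  · have : meetInd s A B * (meetInd s A C * meetInd s B C)
        ≤ (if K < B.card.choose s then (1 : ℝ) else 0) * (meetInd s A B * meetInd s B C) := by
      rw [if_pos hB, one_mul]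
      exact mul_le_mul_of_nonneg_left (mul_le_of_le_one_left z0 y1) x0
    linarith
  by_cases hC : K < C.card.choose s
  · have : meetInd s A B * (meetInd s A C * meetInd s B C)
        ≤ (if K < C.card.choose s then (1 : ℝ) else 0) * (meetInd s A C * meetInd s B C) := by
      rw [if_pos hC, one_mul]
      exact mul_le_of_le_one_left (mul_nonneg y0 z0) x1
    linarith
  by_cases hAB : s ≤ (A ∩ B).card
  swap
  · have : meetInd s A B = 0 := by simp [meetInd, hAB]
    rw [this, zero_mul] at *
    linarith
  by_cases hAC : s ≤ (A ∩ C).card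
  swap
  · have : meetInd s A C = 0 := by simp [meetInd, hAC]
    rw [this, zero_mul, mul_zero] at *
    linarith
  by_cases hBC : s ≤ (B ∩ C).card
  swap
  · have : meetInd s B C = 0 := by simp [meetInd, hBC]
    rw [this, mul_zero, mul_zero] at *
    linarith
  have hlhs : meetInd s A B * (meetInd s A C * meetInd s B C) ≤ 1 := by
    simp [meetInd, hAB, hAC, hBC]
  by_cases hABC : s ≤ ((A ∩ B) ∩ C).card
  · have : (1 : ℝ) ≤ (((A ∩ B) ∩ C).card.choose s : ℝ) := by exact_mod_cast Nat.choose_pos hABC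
    linarith
  · have hie := Finset.card_union_add_card_inter (A ∩ C) (B ∩ C)
    rw [← Finset.union_inter_distrib_right, ← Finset.inter_inter_distrib_right] at hie
    have h1 : (1 : ℝ) ≤ (((A ∪ B) ∩ C).card.choose (s + 1) : ℝ) := by
      exact_mod_cast Nat.choose_pos (by omega)
    have h2 : (1 : ℝ) ≤ ((A ∩ B).card.choose s : ℝ) := by exact_mod_cast Nat.choose_pos hAB
    have h3 : (A ∪ B).card ≤ 2 * (K + s) := by
      have := Finset.card_union_le A B
      have := sub_le_choose hs A.card
      have := sub_le_choose hs B.card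
      omega
    have : (1 : ℝ) ≤ ((A ∩ B).card.choose s : ℝ) *
        ((if (A ∪ B).card ≤ 2 * (K + s) then (1 : ℝ) else 0) *
          ((if K < C.card.choose s then (0 : ℝ) else 1) *
            (((A ∪ B) ∩ C).card.choose (s + 1) : ℝ))) := by
      rw [if_pos h3, if_neg hC, one_mul, one_mul]
      exact one_le_mul_of_one_le_of_one_le h2 h1
    linarith

theorem choose_sq_mul_integral_triple_inter (hsm : s ≤ m) :
    (m.choose s : ℝ) ^ 2 * ∫ A, ∫ B, ∫ C, (((A ∩ B) ∩ C).card.choose s : ℝ)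
        ∂(attributeLaw P) ∂(attributeLaw P) ∂(attributeLaw P) = jointMoment s 1 P ^ 3 := by
  have h := choose_mul_integral_integral_weighted P hsm 0 0
  have h1 := fun A => choose_mul_integral_weighted P hsm A 0
  simp only [pow_zero, one_mul, zero_add] at h h1
  calc _ = (m.choose s : ℝ) * ∫ A, ∫ B, (m.choose s : ℝ) * ∫ C,
        (((A ∩ B) ∩ C).card.choose s : ℝ)
        ∂(attributeLaw P) ∂(attributeLaw P) ∂(attributeLaw P) := by
        simp_rw [integral_const_mul]
        ring
    _ = (m.choose s : ℝ) * ((∫ A, ∫ B, ((A ∩ B).card.choose s : ℝ)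
        ∂(attributeLaw P) ∂(attributeLaw P)) * jointMoment s 1 P) := by
        simp_rw [h1, integral_mul_const]
    _ = _ := by
        rw [← mul_assoc, h]
        ring

/-- The configurations of bounded size in which the third set meets the union of an adjacent pair in
more than `s` attributes are rarer than triangles by a factor of order `1 / m`. -/
theorem choose_sq_mul_integral_large_overlap_le (hs : 0 < s) (hsm : s < m) (K : ℕ) :
    (m.choose s : ℝ) ^ 2 * ∫ A, ∫ B, ∫ C, ((A ∩ B).card.choose s : ℝ) *
          ((if (A ∪ B).card ≤ 2 * (K + s) then 1 else 0) *
          ((if K < C.card.choose s then 0 else 1) * (((A ∪ B) ∩ C).card.choose (s + 1) : ℝ)))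
        ∂(attributeLaw P) ∂(attributeLaw P) ∂(attributeLaw P)
      ≤ jointMoment s 1 P ^ 2 *
        (((2 * (K + s)).choose (s + 1) : ℝ) * (K : ℝ) ^ 2 / ((m : ℝ) - s)) := by
  have hM : (0 : ℝ) < m.choose s := by exact_mod_cast Nat.choose_pos hsm.le
  have hM1 : (0 : ℝ) < m.choose (s + 1) := by exact_mod_cast Nat.choose_pos hsm
  have hms : (0 : ℝ) < (m : ℝ) - s := sub_pos.2 (by exact_mod_cast hsm)
  have hMM : ((s : ℝ) + 1) * (m.choose (s + 1) : ℝ) = (m.choose s : ℝ) * ((m : ℝ) - s) := by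
    have := Nat.choose_succ_right_eq m s
    rw [← Nat.cast_sub hsm.le, mul_comm]
    exact_mod_cast this
  set c : ℝ := ((2 * (K + s)).choose (s + 1) : ℝ) with hc
  have hI : (m.choose s : ℝ) * ((∫ C, (if K < C.card.choose s then 0 else 1) *
      (C.card.choose (s + 1) : ℝ) ∂(attributeLaw P)) / (m.choose (s + 1) : ℝ))
        ≤ (K : ℝ) ^ 2 / ((m : ℝ) - s) := by
    have h1 : ((s : ℝ) + 1) * ∫ C, (if K < C.card.choose s then 0 else 1) *
        (C.card.choose (s + 1) : ℝ) ∂(attributeLaw P) ≤ (K : ℝ) ^ 2 := by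
      rw [← integral_const_mul]
      refine (integral_mono_attributeLaw P (g := fun _ => (K : ℝ) ^ 2) fun C => ?_).trans
        (by simp)
      split_ifs with h
      · simp only [zero_mul, mul_zero]; positivity
      · have h2 : ((C.card.choose s : ℕ) : ℝ) ≤ K := by exact_mod_cast not_lt.1 h
        rw [one_mul, sq]
        exact (succ_mul_choose_succ_le hs C.card).trans
          (mul_le_mul h2 h2 (by positivity) (by positivity))
    rw [le_div_iff₀ hms, mul_div_assoc', div_mul_eq_mul_div, div_le_iff₀ hM1]
    refine le_trans (le_of_eq ?_) (mul_le_mul_of_nonneg_right h1 hM1.le)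
    linear_combination (-(∫ C, (if K < C.card.choose s then 0 else 1) *
        (C.card.choose (s + 1) : ℝ) ∂(attributeLaw P))) * hMM
  have hpt : ∀ A B : Finset (Fin m), ∫ C, ((A ∩ B).card.choose s : ℝ) *
          ((if (A ∪ B).card ≤ 2 * (K + s) then 1 else 0) *
          ((if K < C.card.choose s then 0 else 1) * (((A ∪ B) ∩ C).card.choose (s + 1) : ℝ)))
        ∂(attributeLaw P)
      ≤ ((A ∩ B).card.choose s : ℝ) * (c * ((∫ C, (if K < C.card.choose s then 0 else 1) *
      (C.card.choose (s + 1) : ℝ) ∂(attributeLaw P)) / (m.choose (s + 1) : ℝ))) := by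
    intro A B
    rw [integral_const_mul, integral_const_mul,
      integral_card_mul_choose_inter P (fun x => if K < x.choose s then 0 else 1)]
    refine mul_le_mul_of_nonneg_left ?_ (by positivity)
    have hq : 0 ≤ (∫ C, (if K < C.card.choose s then 0 else 1) *
      (C.card.choose (s + 1) : ℝ) ∂(attributeLaw P)) / (m.choose (s + 1) : ℝ) :=
      div_nonneg (integral_nonneg fun C => mul_nonneg (by split_ifs <;> simp) (by positivity))
        hM1.le
    split_ifs with h
    · rw [one_mul]
      refine mul_le_mul_of_nonneg_right ?_ hq
      rw [hc]
      exact_mod_cast Nat.choose_le_choose (s + 1) h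
    · rw [zero_mul]; positivity
  have h := choose_mul_integral_integral_weighted P hsm.le 0 0
  simp only [pow_zero, one_mul, zero_add] at h
  refine (mul_le_mul_of_nonneg_left (integral_mono_attributeLaw P fun A =>
    integral_mono_attributeLaw P (hpt A)) (by positivity)).trans ?_
  simp_rw [integral_mul_const]
  calc _ = ((m.choose s : ℝ) * ∫ A, ∫ B, ((A ∩ B).card.choose s : ℝ)
          ∂(attributeLaw P) ∂(attributeLaw P)) * (c * ((m.choose s : ℝ) *
          ((∫ C, (if K < C.card.choose s then 0 else 1) *
            (C.card.choose (s + 1) : ℝ) ∂(attributeLaw P)) / (m.choose (s + 1) : ℝ)))) := by ring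
    _ ≤ (jointMoment s 1 P * jointMoment s 1 P) * (c * ((K : ℝ) ^ 2 / ((m : ℝ) - s))) := by
        rw [h]
        refine mul_le_mul_of_nonneg_left (mul_le_mul_of_nonneg_left hI (by positivity)) ?_
        exact mul_nonneg (jointMoment_nonneg P 1) (jointMoment_nonneg P 1)
    _ = _ := by ring

/-- The main term comes from triangles whose three attribute sets have `s` common elements. -/
theorem choose_pow_mul_triangleProb_le (hs : 0 < s) (hsm : s < m) (K : ℕ) :
    (m.choose s : ℝ) ^ 2 * triangleProb s P
      ≤ jointMoment s 1 P ^ 3 + 3 * (jointMoment s 1 P ^ 2 * tailMoment s P 2 K)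
        + jointMoment s 1 P ^ 2 *
          (((2 * (K + s)).choose (s + 1) : ℝ) * (K : ℝ) ^ 2 / ((m : ℝ) - s)) := by
  have h1 := choose_sq_mul_integral_triple_inter P hsm.le
  have h2 := choose_sq_mul_integral_large_le P hsm.le K
  have h3 := integral_three_swap_left P (fun A B C =>
    (if K < A.card.choose s then 1 else 0) * (meetInd s A B * meetInd s A C))
  have h4 := integral_three_rotate P (fun A B C =>
    (if K < A.card.choose s then 1 else 0) * (meetInd s A B * meetInd s A C))
  have h5 := choose_sq_mul_integral_large_overlap_le P hs hsm K
  have hmono := integral_mono_attributeLaw P fun A => integral_mono_attributeLaw P fun B =>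
    integral_mono_attributeLaw P (triangle_pointwise_le hs K A B)
  have hadd : ∀ f g : Finset (Fin m) → Finset (Fin m) → Finset (Fin m) → ℝ,
      ∫ A, ∫ B, ∫ C, (f A B C + g A B C)
        ∂(attributeLaw P) ∂(attributeLaw P) ∂(attributeLaw P)
      = (∫ A, ∫ B, ∫ C, f A B C ∂(attributeLaw P) ∂(attributeLaw P) ∂(attributeLaw P))
        + ∫ A, ∫ B, ∫ C, g A B C ∂(attributeLaw P) ∂(attributeLaw P) ∂(attributeLaw P) := by
    intro f g
    simp_rw [integral_add Integrable.of_finite Integrable.of_finite]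
  rw [hadd, hadd, hadd, hadd, h3, h4] at hmono
  have := mul_le_mul_of_nonneg_left hmono (by positivity : (0 : ℝ) ≤ (m.choose s : ℝ) ^ 2)
  rw [triangleProb]
  linarith

end DensityBounds

/-! ### Factorial moments of a mixed Poisson law -/

section MixedPoisson

variable {Ω : Type*} [MeasurableSpace Ω] {ν : Measure Ω} {Z : Ω → ℝ}

theorem hasSum_descFactorial_mul_poisson (l : ℝ) (i : ℕ) :
    HasSum (fun k : ℕ => (k.descFactorial i : ℝ) * ((k.factorial : ℝ)⁻¹ * (l ^ k * Real.exp (-l))))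
      (l ^ i) := by
  have h1 : HasSum (fun k : ℕ => l ^ k / (k.factorial : ℝ)) (Real.exp l) := by
    rw [Real.exp_eq_exp_ℝ]
    exact NormedSpace.expSeries_div_hasSum_exp l
  have h2 := h1.mul_left (l ^ i * Real.exp (-l))
  rw [mul_assoc, ← Real.exp_add, neg_add_cancel, Real.exp_zero, mul_one] at h2
  rw [← hasSum_nat_add_iff' i, Finset.sum_eq_zero, sub_zero]
  · refine h2.congr_fun fun k => ?_
    have h3 : (k.factorial : ℝ) * ((k + i).descFactorial i : ℝ) = ((k + i).factorial : ℝ) := by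
      have := Nat.factorial_mul_descFactorial (Nat.le_add_left i k)
      rw [Nat.add_sub_cancel] at this
      exact_mod_cast this
    have h4 : (k.factorial : ℝ) ≠ 0 := by positivity
    have h5 : ((k + i).descFactorial i : ℝ) ≠ 0 := by
      intro h0
      rw [h0, mul_zero] at h3
      exact (by positivity : ((k + i).factorial : ℝ) ≠ 0) h3.symm
    rw [← h3, pow_add]
    field_simp
  · intro k hk
    rw [Nat.descFactorial_of_lt (Finset.mem_range.1 hk)]
    simp

theorem factMoment_eq (hZm : AEMeasurable Z ν) (hZ : ∀ᵐ ω ∂ν, 0 ≤ Z ω) {i : ℕ}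
    (hi : Integrable (fun ω => Z ω ^ i) ν) :
    FactMomentFinite ν Z i ∧ factMoment ν Z i = (∫ ω, Z ω ∂ν) ^ i * ∫ ω, Z ω ^ i ∂ν := by
  set z := ∫ ω, Z ω ∂ν with hz
  have hz0 : 0 ≤ z := integral_nonneg_of_ae hZ
  set F : ℕ → Ω → ℝ := fun k ω => (k.descFactorial i : ℝ) *
    ((k.factorial : ℝ)⁻¹ * ((z * Z ω) ^ k * Real.exp (-(z * Z ω)))) with hF
  have hterm : ∀ k : ℕ, (k.descFactorial i : ℝ) * asympDegreeProb ν Z k = ∫ ω, F k ω ∂ν := by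
    intro k
    rw [hF]
    dsimp only
    rw [integral_const_mul, integral_const_mul]
    rfl
  have hsum : ∀ ω, HasSum (fun k => F k ω) ((z * Z ω) ^ i) := fun ω =>
    hasSum_descFactorial_mul_poisson (z * Z ω) i
  have hF0 : ∀ᵐ ω ∂ν, ∀ k, 0 ≤ F k ω := by
    filter_upwards [hZ] with ω hω k
    simp only [hF]
    positivity
  have hlim : Integrable (fun ω => (z * Z ω) ^ i) ν := by
    simp_rw [mul_pow]
    exact hi.const_mul _
  have hFi : ∀ k, Integrable (F k) ν := by
    intro k
    refine hlim.mono' ?_ ?_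
    · have : AEMeasurable (F k) ν := by
        simp only [hF]
        fun_prop
      exact this.aestronglyMeasurable
    · filter_upwards [hF0] with ω hω
      rw [Real.norm_of_nonneg (hω k)]
      exact le_hasSum (hsum ω) k fun j _ => hω j
  have hnorm : ∀ k, ∫ ω, ‖F k ω‖ ∂ν = ∫ ω, F k ω ∂ν := fun k => by
    refine integral_congr_ae ?_
    filter_upwards [hF0] with ω hω
    rw [Real.norm_of_nonneg (hω k)]
  have hsummable : Summable fun k => ∫ ω, F k ω ∂ν := by
    refine summable_of_sum_le (c := ∫ ω, (z * Z ω) ^ i ∂ν) (fun k => integral_nonneg_of_ae ?_) ?_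
    · filter_upwards [hF0] with ω hω using hω k
    · intro T
      rw [← integral_finsetSum _ fun k _ => hFi k]
      refine integral_mono_ae (integrable_finsetSum _ fun k _ => hFi k) hlim ?_
      filter_upwards [hF0] with ω hω
      exact sum_le_hasSum T (fun k _ => hω k) (hsum ω)
  have hmain := hasSum_integral_of_summable_integral_norm hFi (by simpa only [hnorm] using hsummable)
  simp_rw [fun ω => (hsum ω).tsum_eq, mul_pow, integral_const_mul] at hmain
  constructor
  · unfold FactMomentFinite
    simp_rw [hterm]
    exact hsummable
  · unfold factMoment
    simp_rw [hterm]
    exact hmain.tsum_eq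

end MixedPoisson

/-! ### Moments under convergence in distribution -/

section Distribution

variable {Ω : Type*} [MeasurableSpace Ω] {ν : Measure Ω} {Z : Ω → ℝ}

theorem pow_sub_min_pow_le {x K : ℝ} (hx : 0 ≤ x) (hK : 1 ≤ K) {j k : ℕ} (hjk : j ≤ k) :
    x ^ j - min x K ^ j ≤ x ^ k - min x K ^ k := by
  rcases le_total x K with h | h
  · simp [min_eq_left h]
  · rw [min_eq_right h]
    obtain ⟨d, rfl⟩ := Nat.exists_eq_add_of_le hjk
    have h1 : K ^ j ≤ x ^ j := pow_le_pow_left₀ (by linarith) h j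
    have h2 : K ^ d ≤ x ^ d := pow_le_pow_left₀ (by linarith) h d
    have h3 : 1 ≤ K ^ d := one_le_pow₀ hK
    rw [pow_add, pow_add]
    have h4 : K ^ j * (K ^ d - 1) ≤ x ^ j * (x ^ d - 1) :=
      mul_le_mul h1 (by linarith) (by linarith) (by positivity)
    linarith

theorem min_pow_le_pow {x K : ℝ} (hx : 0 ≤ x) (hK : 0 ≤ K) (j : ℕ) : min x K ^ j ≤ x ^ j :=
  pow_le_pow_left₀ (le_min hx hK) (min_le_left _ _) j

theorem tail_pow_le {x K : ℝ} (hx : 0 ≤ x) (hK : 0 ≤ K) {j : ℕ} (hj : 1 ≤ j) :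
    (if 2 * K < x then x ^ j else 0) ≤ 2 * (x ^ j - min x K ^ j) := by
  split_ifs with h
  · have h1 : K ≤ x / 2 := by linarith
    have h2 : min x K ^ j ≤ (x / 2) ^ j :=
      pow_le_pow_left₀ (le_min hx hK) ((min_le_right _ _).trans h1) j
    have h3 : (x / 2) ^ j ≤ x ^ j / 2 := by
      rw [div_pow]
      have : (2 : ℝ) ≤ 2 ^ j := le_self_pow₀ (by norm_num) (by omega)
      exact div_le_div_of_nonneg_left (by positivity) (by norm_num) this
    linarith
  · have := min_pow_le_pow hx hK j
    linarith

theorem tendsto_integral_min_pow_nat (hZm : AEMeasurable Z ν) (hZ : ∀ᵐ ω ∂ν, 0 ≤ Z ω) {j : ℕ}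
    (hj : Integrable (fun ω => Z ω ^ j) ν) :
    Tendsto (fun K : ℕ => ∫ ω, min (Z ω) K ^ j ∂ν) atTop (𝓝 (∫ ω, Z ω ^ j ∂ν)) := by
  refine tendsto_integral_of_dominated_convergence (fun ω => Z ω ^ j)
    (fun K => ((hZm.min aemeasurable_const).pow_const j).aestronglyMeasurable) hj ?_ ?_
  · intro K
    filter_upwards [hZ] with ω hω
    rw [Real.norm_of_nonneg (pow_nonneg (le_min hω (Nat.cast_nonneg K)) j)]
    exact min_pow_le_pow hω (Nat.cast_nonneg K) j
  · refine .of_forall fun ω => tendsto_const_nhds.congr' ?_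
    filter_upwards [eventually_ge_atTop ⌈Z ω⌉₊] with K hK
    rw [min_eq_left ((Nat.le_ceil _).trans (by exact_mod_cast hK))]

theorem integral_pow_pos (hZ : ∀ᵐ ω ∂ν, 0 ≤ Z ω) {j k : ℕ} (hk : k ≠ 0)
    (hj : Integrable (fun ω => Z ω ^ j) ν) (hpos : 0 < ∫ ω, Z ω ^ k ∂ν) :
    0 < ∫ ω, Z ω ^ j ∂ν := by
  have h0 : 0 ≤ᵐ[ν] fun ω => Z ω ^ j := by
    filter_upwards [hZ] with ω hω using pow_nonneg hω j
  refine lt_of_le_of_ne (integral_nonneg_of_ae h0) fun heq => hpos.ne' ?_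
  have h1 := (integral_eq_zero_iff_of_nonneg_ae h0 hj).1 heq.symm
  refine integral_eq_zero_of_ae ?_
  filter_upwards [h1] with ω hω
  have h2 : Z ω ^ j = 0 := hω
  simp [eq_zero_of_pow_eq_zero h2, hk]

variable [IsProbabilityMeasure ν]

section Limit

variable {Ω' : ℕ → Type*} [∀ n, MeasurableSpace (Ω' n)] {μ : ∀ n, Measure (Ω' n)}
  [∀ n, IsProbabilityMeasure (μ n)] {X : ∀ n, Ω' n → ℝ}

theorem tendsto_integral_comp_of_tendstoInDistribution
    (h : TendstoInDistribution X atTop Z μ ν) {φ : ℝ → ℝ} (hφ : Continuous φ) {C : ℝ}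
    (hC : ∀ x, ‖φ x‖ ≤ C) :
    Tendsto (fun n => ∫ ω, φ (X n ω) ∂(μ n)) atTop (𝓝 (∫ ω, φ (Z ω) ∂ν)) := by
  have h1 := ProbabilityMeasure.tendsto_iff_forall_integral_tendsto.1 h.tendsto
    (BoundedContinuousFunction.ofNormedAddCommGroup φ hφ C hC)
  simp only [ProbabilityMeasure.coe_mk, BoundedContinuousFunction.coe_ofNormedAddCommGroup] at h1
  rw [integral_map h.aemeasurable_limit hφ.aestronglyMeasurable] at h1
  refine h1.congr fun n => ?_
  rw [integral_map (h.forall_aemeasurable n) hφ.aestronglyMeasurable]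

theorem ae_nonneg_of_tendstoInDistribution (h : TendstoInDistribution X atTop Z μ ν)
    (hX : ∀ n ω, 0 ≤ X n ω) : ∀ᵐ ω ∂ν, 0 ≤ Z ω := by
  -- test against the bounded function that vanishes exactly on `[0, ∞)`
  have hc : Continuous fun x : ℝ => max 0 (min 1 (-x)) := by fun_prop
  have hb : ∀ x : ℝ, ‖max 0 (min 1 (-x))‖ ≤ 1 := fun x => by
    rw [Real.norm_of_nonneg (le_max_left _ _)]
    exact max_le zero_le_one (min_le_left _ _)
  have h1 := tendsto_integral_comp_of_tendstoInDistribution h hc hb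
  have h0 : ∀ n, ∫ ω, max 0 (min 1 (-X n ω)) ∂(μ n) = 0 := by
    intro n
    have : ∀ ω, max 0 (min 1 (-X n ω)) = 0 := fun ω =>
      max_eq_left ((min_le_right _ _).trans (by linarith [hX n ω]))
    simp [this]
  simp_rw [h0] at h1
  have h2 := tendsto_nhds_unique h1 tendsto_const_nhds
  have hint : Integrable (fun ω => max 0 (min 1 (-Z ω))) ν :=
    Integrable.of_bound (hc.comp_aestronglyMeasurable h.aemeasurable_limit.aestronglyMeasurable) 1
      (.of_forall fun ω => hb (Z ω))
  have hn : (0 : Ω → ℝ) ≤ fun ω => max 0 (min 1 (-Z ω)) := fun ω => le_max_left _ _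
  rw [integral_eq_zero_iff_of_nonneg hn hint] at h2
  filter_upwards [h2] with ω hω
  by_contra hneg
  have h3 : 0 < min 1 (-Z ω) := lt_min one_pos (by linarith)
  have h4 : max 0 (min 1 (-Z ω)) = 0 := hω
  have h5 := le_max_right 0 (min 1 (-Z ω))
  linarith

theorem tendsto_integral_min_pow (h : TendstoInDistribution X atTop Z μ ν)
    (hX : ∀ n ω, 0 ≤ X n ω) {K : ℝ} (hK : 0 ≤ K) (j : ℕ) :
    Tendsto (fun n => ∫ ω, min (X n ω) K ^ j ∂(μ n)) atTop (𝓝 (∫ ω, min (Z ω) K ^ j ∂ν)) := by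
  have hc : Continuous fun x : ℝ => min (max x 0) K ^ j := by fun_prop
  have hb : ∀ x : ℝ, ‖min (max x 0) K ^ j‖ ≤ K ^ j := fun x => by
    have h0 : 0 ≤ min (max x 0) K := le_min (le_max_right _ _) hK
    rw [Real.norm_of_nonneg (pow_nonneg h0 j)]
    exact pow_le_pow_left₀ h0 (min_le_right _ _) j
  have h1 := tendsto_integral_comp_of_tendstoInDistribution h hc hb
  have hZ : ∫ ω, min (max (Z ω) 0) K ^ j ∂ν = ∫ ω, min (Z ω) K ^ j ∂ν := by
    refine integral_congr_ae ?_
    filter_upwards [ae_nonneg_of_tendstoInDistribution h hX] with ω hω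
    rw [max_eq_left hω]
  rw [← hZ]
  refine h1.congr fun n => integral_congr_ae (.of_forall fun ω => ?_)
  simp [max_eq_left (hX n ω)]

end Limit

theorem integrable_min_pow (hZm : AEMeasurable Z ν) (hZ : ∀ᵐ ω ∂ν, 0 ≤ Z ω) {K : ℝ} (hK : 0 ≤ K)
    (j : ℕ) : Integrable (fun ω => min (Z ω) K ^ j) ν := by
  refine Integrable.of_bound ((hZm.min aemeasurable_const).pow_const j).aestronglyMeasurable
    (K ^ j) ?_
  filter_upwards [hZ] with ω hω
  rw [Real.norm_of_nonneg (pow_nonneg (le_min hω hK) j)]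
  exact pow_le_pow_left₀ (le_min hω hK) (min_le_right _ _) j

theorem integrable_pow_of_le (hZm : AEMeasurable Z ν) (hZ : ∀ᵐ ω ∂ν, 0 ≤ Z ω) {j k : ℕ}
    (hjk : j ≤ k) (hk : Integrable (fun ω => Z ω ^ k) ν) : Integrable (fun ω => Z ω ^ j) ν := by
  refine Integrable.mono' ((integrable_const (1 : ℝ)).add hk)
    (hZm.pow_const j).aestronglyMeasurable ?_
  filter_upwards [hZ] with ω hω
  rw [Real.norm_of_nonneg (pow_nonneg hω j)]
  simp only [Pi.add_apply]
  rcases le_total (Z ω) 1 with h1 | h1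
  · linarith [pow_le_one₀ hω h1 (n := j), pow_nonneg hω k]
  · linarith [pow_le_pow_right₀ h1 hjk]

/-- If the `j`-th moment is infinite, the truncated moments are unbounded. -/
theorem exists_le_integral_min_pow (hZm : AEMeasurable Z ν) (hZ : ∀ᵐ ω ∂ν, 0 ≤ Z ω) {j : ℕ}
    (hj : ∫⁻ ω, ENNReal.ofReal (Z ω ^ j) ∂ν = ⊤) (R : ℝ) :
    ∃ K : ℕ, R ≤ ∫ ω, min (Z ω) K ^ j ∂ν := by
  have h1 : Tendsto (fun K : ℕ => ∫⁻ ω, ENNReal.ofReal (min (Z ω) K ^ j) ∂ν) atTop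
      (𝓝 (∫⁻ ω, ENNReal.ofReal (Z ω ^ j) ∂ν)) := by
    refine lintegral_tendsto_of_tendsto_of_monotone
      (fun K => ((hZm.min aemeasurable_const).pow_const j).ennreal_ofReal) ?_ ?_
    · filter_upwards [hZ] with ω hω
      intro a b hab
      refine ENNReal.ofReal_le_ofReal (pow_le_pow_left₀ (le_min hω (Nat.cast_nonneg a)) ?_ j)
      exact min_le_min_left _ (by exact_mod_cast hab)
    · refine .of_forall fun ω => tendsto_const_nhds.congr' ?_
      filter_upwards [eventually_ge_atTop ⌈Z ω⌉₊] with K hK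
      rw [min_eq_left ((Nat.le_ceil _).trans (by exact_mod_cast hK))]
  rw [hj] at h1
  obtain ⟨K, hK⟩ := ((ENNReal.tendsto_nhds_top_iff_nnreal.1 h1) R.toNNReal).exists
  refine ⟨K, ?_⟩
  rw [← ofReal_integral_eq_lintegral_ofReal (integrable_min_pow hZm hZ (Nat.cast_nonneg K) j)] at hK
  · have h2 : ENNReal.ofReal R < ENNReal.ofReal (∫ ω, min (Z ω) K ^ j ∂ν) := hK
    exact (ENNReal.ofReal_lt_ofReal_iff'.1 h2).1.le
  · filter_upwards [hZ] with ω hω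
    exact pow_nonneg (le_min hω (Nat.cast_nonneg K)) j

section Limit

variable {Ω' : ℕ → Type*} [∀ n, MeasurableSpace (Ω' n)] {μ : ∀ n, Measure (Ω' n)}
  [∀ n, IsProbabilityMeasure (μ n)] {X : ∀ n, Ω' n → ℝ}

/-- Convergence of the `k`-th moment makes the truncation error of all lower moments uniformly
small. -/
theorem exists_eventually_integral_sub_min_le (h : TendstoInDistribution X atTop Z μ ν)
    (hX : ∀ n ω, 0 ≤ X n ω) (hXi : ∀ n j, Integrable (fun ω => X n ω ^ j) (μ n)) {k : ℕ}
    (hk : Integrable (fun ω => Z ω ^ k) ν)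
    (hlim : Tendsto (fun n => ∫ ω, X n ω ^ k ∂(μ n)) atTop (𝓝 (∫ ω, Z ω ^ k ∂ν)))
    {ε : ℝ} (hε : 0 < ε) :
    ∃ K₀ : ℕ, ∀ K : ℕ, K₀ ≤ K → ∀ᶠ n in atTop, ∀ j ≤ k,
      ∫ ω, X n ω ^ j ∂(μ n) - ∫ ω, min (X n ω) K ^ j ∂(μ n) ≤ ε := by
  have hZ := ae_nonneg_of_tendstoInDistribution h hX
  have hZm := h.aemeasurable_limit
  have h1 := tendsto_integral_min_pow_nat hZm hZ hk
  obtain ⟨K₁, hK₁⟩ := eventually_atTop.1 (h1.eventually_const_lt (sub_lt_self _ (half_pos hε)))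
  refine ⟨max K₁ 1, fun K hK => ?_⟩
  have h2 := hK₁ K ((le_max_left _ _).trans hK)
  have hK1 : (1 : ℝ) ≤ K := by exact_mod_cast (le_max_right K₁ 1).trans hK
  have h3 := (hlim.sub (tendsto_integral_min_pow h hX (Nat.cast_nonneg K) k)).eventually_lt_const
    (show ∫ ω, Z ω ^ k ∂ν - ∫ ω, min (Z ω) K ^ k ∂ν < ε by linarith)
  filter_upwards [h3] with n hn j hj
  refine le_trans ?_ hn.le
  have hi : ∀ i, Integrable (fun ω => min (X n ω) K ^ i) (μ n) := fun i =>
    integrable_min_pow (h.forall_aemeasurable n) (.of_forall (hX n)) (Nat.cast_nonneg K) i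
  rw [← integral_sub (hXi n j) (hi j), ← integral_sub (hXi n k) (hi k)]
  exact integral_mono ((hXi n j).sub (hi j)) ((hXi n k).sub (hi k)) fun ω =>
    pow_sub_min_pow_le (hX n ω) hK1 hj

theorem tendsto_integral_pow_of_le (h : TendstoInDistribution X atTop Z μ ν)
    (hX : ∀ n ω, 0 ≤ X n ω) (hXi : ∀ n j, Integrable (fun ω => X n ω ^ j) (μ n)) {k : ℕ}
    (hk : Integrable (fun ω => Z ω ^ k) ν)
    (hlim : Tendsto (fun n => ∫ ω, X n ω ^ k ∂(μ n)) atTop (𝓝 (∫ ω, Z ω ^ k ∂ν)))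
    {j : ℕ} (hjk : j ≤ k) :
    Tendsto (fun n => ∫ ω, X n ω ^ j ∂(μ n)) atTop (𝓝 (∫ ω, Z ω ^ j ∂ν)) := by
  have hZ := ae_nonneg_of_tendstoInDistribution h hX
  have hZm := h.aemeasurable_limit
  have hj := integrable_pow_of_le hZm hZ hjk hk
  rw [Metric.tendsto_nhds]
  intro ε hε
  obtain ⟨K₀, hK₀⟩ :=
    exists_eventually_integral_sub_min_le h hX hXi hk hlim (show 0 < ε / 4 by positivity)
  have h1 := tendsto_integral_min_pow_nat hZm hZ hj
  obtain ⟨K, hK, hK'⟩ := ((eventually_ge_atTop K₀).and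
    (Metric.tendsto_nhds.1 h1 (ε / 4) (by positivity))).exists
  have h2 := Metric.tendsto_nhds.1 (tendsto_integral_min_pow h hX (Nat.cast_nonneg K) j) (ε / 4)
    (by positivity)
  filter_upwards [hK₀ K hK, h2] with n hn1 hn2
  have hn3 := hn1 j hjk
  have hi : Integrable (fun ω => min (X n ω) (K : ℝ) ^ j) (μ n) :=
    integrable_min_pow (h.forall_aemeasurable n) (.of_forall (hX n)) (Nat.cast_nonneg K) j
  have hn4 : ∫ ω, min (X n ω) (K : ℝ) ^ j ∂(μ n) ≤ ∫ ω, X n ω ^ j ∂(μ n) :=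
    integral_mono hi (hXi n j) fun ω => min_pow_le_pow (hX n ω) (Nat.cast_nonneg K) j
  rw [Real.dist_eq, abs_lt] at *
  constructor <;> linarith [hK'.1, hK'.2, hn2.1, hn2.2]

theorem exists_eventually_tail_le (h : TendstoInDistribution X atTop Z μ ν)
    (hX : ∀ n ω, 0 ≤ X n ω) (hXi : ∀ n j, Integrable (fun ω => X n ω ^ j) (μ n)) {k : ℕ}
    (hk : Integrable (fun ω => Z ω ^ k) ν)
    (hlim : Tendsto (fun n => ∫ ω, X n ω ^ k ∂(μ n)) atTop (𝓝 (∫ ω, Z ω ^ k ∂ν)))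
    {j : ℕ} (hj : 1 ≤ j) (hjk : j ≤ k) {ε : ℝ} (hε : 0 < ε) :
    ∃ K : ℕ, ∀ᶠ n in atTop, ∫ ω, (if (K : ℝ) < X n ω then X n ω ^ j else 0) ∂(μ n) ≤ ε := by
  obtain ⟨K, hK⟩ :=
    exists_eventually_integral_sub_min_le h hX hXi hk hlim (show 0 < ε / 2 by positivity)
  refine ⟨2 * K, ?_⟩
  filter_upwards [hK K le_rfl] with n hn
  have hi : Integrable (fun ω => min (X n ω) (K : ℝ) ^ j) (μ n) :=
    integrable_min_pow (h.forall_aemeasurable n) (.of_forall (hX n)) (Nat.cast_nonneg K) j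
  have h1 : ∫ ω, (if ((2 * K : ℕ) : ℝ) < X n ω then X n ω ^ j else 0) ∂(μ n)
      ≤ ∫ ω, 2 * (X n ω ^ j - min (X n ω) (K : ℝ) ^ j) ∂(μ n) := by
    refine integral_mono_of_nonneg (.of_forall fun ω => ?_)
      (((hXi n j).sub hi).const_mul 2) (.of_forall fun ω => ?_)
    · dsimp only
      split_ifs
      · exact pow_nonneg (hX n ω) j
      · exact le_rfl
    · have := tail_pow_le (hX n ω) (Nat.cast_nonneg K) hj
      push_cast
      exact this
  rw [integral_const_mul, integral_sub (hXi n j) hi] at h1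
  have := hn j hjk
  linarith

end Limit

/-- The Cauchy-Schwarz inequality for the moments of a nonnegative variable. -/
theorem sq_integral_sq_le (hZm : AEMeasurable Z ν) (hZ : ∀ᵐ ω ∂ν, 0 ≤ Z ω)
    (h3 : Integrable (fun ω => Z ω ^ 3) ν) (hpos : 0 < ∫ ω, Z ω ^ 1 ∂ν) :
    (∫ ω, Z ω ^ 2 ∂ν) ^ 2 ≤ (∫ ω, Z ω ^ 1 ∂ν) * ∫ ω, Z ω ^ 3 ∂ν := by
  have i1 := integrable_pow_of_le hZm hZ (show 1 ≤ 3 by norm_num) h3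
  have i2 := integrable_pow_of_le hZm hZ (show 2 ≤ 3 by norm_num) h3
  set z₁ := ∫ ω, Z ω ^ 1 ∂ν with hz₁
  set z₂ := ∫ ω, Z ω ^ 2 ∂ν with hz₂
  have h : 0 ≤ ∫ ω, (z₁ ^ 2 * Z ω ^ 3 - 2 * z₁ * z₂ * Z ω ^ 2 + z₂ ^ 2 * Z ω ^ 1) ∂ν := by
    refine integral_nonneg_of_ae ?_
    filter_upwards [hZ] with ω hω
    have : 0 ≤ Z ω * (z₁ * Z ω - z₂) ^ 2 := by positivity
    refine this.trans (le_of_eq ?_)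
    ring
  have i23 : Integrable (fun ω => z₁ ^ 2 * Z ω ^ 3 - 2 * z₁ * z₂ * Z ω ^ 2) ν :=
    (h3.const_mul _).sub (i2.const_mul _)
  rw [integral_add i23 (i1.const_mul _), integral_sub (h3.const_mul _) (i2.const_mul _),
    integral_const_mul, integral_const_mul,
    integral_const_mul, ← hz₁, ← hz₂] at h
  have h4 : 0 ≤ z₁ * (z₁ * (∫ ω, Z ω ^ 3 ∂ν) - z₂ ^ 2) := by nlinarith
  linarith [nonneg_of_mul_nonneg_right h4 hpos]

end Distribution

/-! ### Limits of the rescaled densities -/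

section DensityLimits

variable {s : ℕ} {m : ℕ → ℕ} {P : ∀ n, PMF (Fin (m n + 1))}

/-- Uniform integrability, asymptotically in `n`, of the `k`-th powers of `Y = binom(X, s)`. -/
def UniformTail (s : ℕ) {m : ℕ → ℕ} (P : ∀ n, PMF (Fin (m n + 1))) (k : ℕ) : Prop :=
  ∀ ε : ℝ, 0 < ε → ∃ K : ℕ, ∀ᶠ n in atTop, tailMoment s (P n) k K ≤ ε

theorem tendsto_const_div_sub (hm : Tendsto m atTop atTop) (s : ℕ) (c : ℝ) :
    Tendsto (fun n => c / ((m n : ℝ) - s)) atTop (𝓝 0) :=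
  tendsto_const_nhds.div_atTop
    (tendsto_atTop_add_const_right _ (-(s : ℝ)) (tendsto_natCast_atTop_atTop.comp hm))

theorem tendsto_defectMoment (hs : 0 < s) (hm : Tendsto m atTop atTop) {j l : ℕ} {x y : ℝ}
    (hj : UniformTail s P (j + 1)) (hl : UniformTail s P (l + 1))
    (hx : Tendsto (fun n => jointMoment s (j + 1) (P n)) atTop (𝓝 x))
    (hy : Tendsto (fun n => jointMoment s (l + 1) (P n)) atTop (𝓝 y)) :
    Tendsto (fun n => defectMoment s (P n) j l) atTop (𝓝 0) := by
  have hx0 : 0 ≤ x := ge_of_tendsto' hx fun n => jointMoment_nonneg (P n) _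
  have hy0 : 0 ≤ y := ge_of_tendsto' hy fun n => jointMoment_nonneg (P n) _
  rw [Metric.tendsto_nhds]
  intro ε hε
  set δ : ℝ := ε / (4 * (x + y + 2)) with hδ
  have hδ0 : 0 < δ := by positivity
  obtain ⟨K₁, h1⟩ := hj δ hδ0
  obtain ⟨K₂, h2⟩ := hl δ hδ0
  set K := max K₁ K₂
  have hmono : ∀ (n k K' : ℕ), K' ≤ K → tailMoment s (P n) k K ≤ tailMoment s (P n) k K' := by
    intro n k K' hK
    refine integral_mono_attributeLaw (P n) fun A => ?_
    split_ifs with ha hb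
    · exact le_rfl
    · omega
    · positivity
    · exact le_rfl
  have h3 : Tendsto (fun n => (K : ℝ) ^ 2 * jointMoment s (j + 1) (P n) *
      jointMoment s (l + 1) (P n) / ((m n : ℝ) - s)) atTop (𝓝 0) := by
    have := ((hx.mul hy).mul (tendsto_const_div_sub hm s ((K : ℝ) ^ 2)))
    rw [mul_zero] at this
    refine this.congr fun n => ?_
    ring
  filter_upwards [h1, h2, h3.eventually_lt_const (show (0 : ℝ) < ε / 2 by positivity),
    hx.eventually_lt_const (show x < x + 1 by linarith),
    hy.eventually_lt_const (show y < y + 1 by linarith), hm.eventually_gt_atTop s]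
    with n e1 e2 e3 ex ey em
  rw [Real.dist_eq, sub_zero, abs_of_nonneg (defectMoment_nonneg _ _ _)]
  have hb := defectMoment_le (P n) hs em j l K
  have t1 := (hmono n (j + 1) K₁ (le_max_left _ _)).trans e1
  have t2 := (hmono n (l + 1) K₂ (le_max_right _ _)).trans e2
  have b1 : tailMoment s (P n) (j + 1) K * jointMoment s (l + 1) (P n) ≤ δ * (y + 1) :=
    mul_le_mul t1 ey.le (jointMoment_nonneg _ _) hδ0.le
  have b2 : jointMoment s (j + 1) (P n) * tailMoment s (P n) (l + 1) K ≤ (x + 1) * δ :=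
    mul_le_mul ex.le t2 (tailMoment_nonneg _ _ _) (by linarith)
  have b3 : δ * (y + 1) + (x + 1) * δ = ε / 4 := by
    rw [hδ]
    field_simp
    ring
  linarith

theorem tendsto_choose_pow_mul_starProb (hs : 0 < s) (hm : Tendsto m atTop atTop) {k : ℕ}
    {x y : ℝ} (h1 : UniformTail s P 1) (hk : UniformTail s P (k + 1))
    (hx : Tendsto (fun n => jointMoment s 1 (P n)) atTop (𝓝 x))
    (hy : Tendsto (fun n => jointMoment s (k + 1) (P n)) atTop (𝓝 y)) :
    Tendsto (fun n => ((m n).choose s : ℝ) ^ (k + 1) * starProb s (P n) (k + 1)) atTop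
      (𝓝 (x ^ (k + 1) * y)) := by
  have hd := tendsto_defectMoment hs hm (l := 0) hk h1 hy hx
  have hup := (hx.pow (k + 1)).mul hy
  have hlow := hup.sub (((hx.pow k).const_mul ((k : ℝ) + 1)).mul hd)
  rw [mul_zero, sub_zero] at hlow
  refine tendsto_of_tendsto_of_tendsto_of_le_of_le' hlow hup ?_ ?_
  · filter_upwards [hm.eventually_ge_atTop s] with n hn
    exact le_choose_pow_mul_starProb (P n) hn k
  · filter_upwards [hm.eventually_ge_atTop s] with n hn
    exact choose_pow_mul_starProb_le (P n) hn (k + 1)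

theorem tendsto_choose_pow_mul_pathProb (hs : 0 < s) (hm : Tendsto m atTop atTop)
    {x y : ℝ} (h1 : UniformTail s P 1) (h2 : UniformTail s P 2)
    (hx : Tendsto (fun n => jointMoment s 1 (P n)) atTop (𝓝 x))
    (hy : Tendsto (fun n => jointMoment s 2 (P n)) atTop (𝓝 y)) :
    Tendsto (fun n => ((m n).choose s : ℝ) ^ 3 * pathProb s (P n)) atTop
      (𝓝 (x ^ 2 * y ^ 2)) := by
  have hd1 := tendsto_defectMoment hs hm (j := 1) (l := 1) h2 h2 hy hy
  have hd2 := tendsto_defectMoment hs hm (j := 1) (l := 0) h2 h1 hy hx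
  have hup := (hx.pow 2).mul (hy.pow 2)
  have hlow := (hup.sub ((hx.pow 2).mul hd1)).sub ((hx.mul (hy.mul hd2)).const_mul 2)
  simp only [mul_zero, sub_zero] at hlow
  refine tendsto_of_tendsto_of_tendsto_of_le_of_le' hlow hup ?_ ?_
  · filter_upwards [hm.eventually_ge_atTop s] with n hn
    exact le_choose_pow_mul_pathProb (P n) hn
  · filter_upwards [hm.eventually_ge_atTop s] with n hn
    exact choose_pow_mul_pathProb_le (P n) hn

theorem tendsto_choose_pow_mul_triangleProb (hs : 0 < s) (hm : Tendsto m atTop atTop)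
    {x : ℝ} (h1 : UniformTail s P 1) (h2 : UniformTail s P 2)
    (hx : Tendsto (fun n => jointMoment s 1 (P n)) atTop (𝓝 x)) :
    Tendsto (fun n => ((m n).choose s : ℝ) ^ 2 * triangleProb s (P n)) atTop (𝓝 (x ^ 3)) := by
  have hlow := (tendsto_choose_pow_mul_starProb hs hm (k := 0) h1 h1 hx hx).mul hx
  simp only [zero_add, pow_one] at hlow
  rw [show x * x * x = x ^ 3 by ring] at hlow
  rw [Metric.tendsto_nhds]
  intro ε hε
  set δ : ℝ := ε / (6 * (x ^ 2 + 1)) with hδ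
  have hδ0 : 0 < δ := by positivity
  obtain ⟨K, hK⟩ := h2 δ hδ0
  have hup := (hx.pow 3).add (((hx.pow 2).mul
    (tendsto_const_nhds (x := δ) (f := atTop))).const_mul 3)
  have hup' := hup.add ((hx.pow 2).mul
    (tendsto_const_div_sub hm s (((2 * (K + s)).choose (s + 1) : ℝ) * (K : ℝ) ^ 2)))
  have hlt : x ^ 3 + 3 * (x ^ 2 * δ) + x ^ 2 * 0 < x ^ 3 + ε := by
    have : 3 * (x ^ 2 * δ) < ε := by
      have h6 : 3 * ((x ^ 2 + 1) * δ) = ε / 2 := by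
        rw [hδ]; field_simp; norm_num
      nlinarith
    linarith
  filter_upwards [hK, hup'.eventually_lt_const hlt,
    hlow.eventually_const_lt (sub_lt_self (x ^ 3) hε), hm.eventually_gt_atTop s] with n e1 e2 e3 em
  have b1 := le_choose_pow_mul_triangleProb (P n) em.le
  have b2 := choose_pow_mul_triangleProb_le (P n) hs em K
  have b3 : jointMoment s 1 (P n) ^ 2 * tailMoment s (P n) 2 K ≤ jointMoment s 1 (P n) ^ 2 * δ :=
    mul_le_mul_of_nonneg_left e1 (sq_nonneg _)
  rw [Real.dist_eq, abs_lt]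
  constructor <;> linarith

theorem tendsto_choose_pow_mul_starProb_three_atTop (hs : 0 < s) (hm : Tendsto m atTop atTop)
    {x : ℝ} (h1 : UniformTail s P 1)
    (hx : Tendsto (fun n => jointMoment s 1 (P n)) atTop (𝓝 x)) (hx0 : 0 < x)
    (htr : ∀ R : ℝ, ∃ K : ℕ, ∀ᶠ n in atTop, R ≤ truncMoment s (P n) 3 K) :
    Tendsto (fun n => ((m n).choose s : ℝ) ^ 3 * starProb s (P n) 3) atTop atTop := by
  rw [tendsto_atTop]
  intro R
  obtain ⟨K, hK⟩ := htr ((max R 0 + 1) / (x / 2) ^ 3)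
  have hd := tendsto_defectMoment hs hm (j := 0) (l := 0) h1 h1 hx hx
  have he := (((hx.pow 2).const_mul 3).mul_const ((K : ℝ) ^ 2)).mul hd
  rw [mul_zero] at he
  filter_upwards [hK, he.eventually_lt_const one_pos,
    hx.eventually_const_lt (half_lt_self hx0), hm.eventually_ge_atTop s] with n e1 e2 e3 em
  have b1 := le_choose_pow_mul_starProb_three (P n) em K
  have b2 : (x / 2) ^ 3 ≤ jointMoment s 1 (P n) ^ 3 :=
    pow_le_pow_left₀ (by positivity) e3.le 3
  have b3 : max R 0 + 1 ≤ jointMoment s 1 (P n) ^ 3 * truncMoment s (P n) 3 K := by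
    calc max R 0 + 1 = (x / 2) ^ 3 * ((max R 0 + 1) / (x / 2) ^ 3) := by field_simp
      _ ≤ _ := mul_le_mul b2 e1 (by positivity)
          (pow_nonneg (jointMoment_nonneg (P n) 1) 3)
  have b4 := le_max_left R 0
  linarith

end DensityLimits

/-! ### From the rescaled joints to the joints -/

section Transfer

variable {Ω : Type*} [MeasurableSpace Ω] {ν : Measure Ω} [IsProbabilityMeasure ν] {Z : Ω → ℝ}
  {s : ℕ} {m : ℕ → ℕ} {P : ∀ n, PMF (Fin (m n + 1))} {β : ℝ}

theorem rescaledJoints_nonneg (n : ℕ) {m : ℕ} (A : Finset (Fin m)) : 0 ≤ rescaledJoints s n A := by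
  unfold rescaledJoints
  positivity

theorem choose_card_eq_sqrt_mul {n m : ℕ} (hn : 0 < n) (hm : s ≤ m) (A : Finset (Fin m)) :
    (A.card.choose s : ℝ) = √((m.choose s : ℝ) / n) * rescaledJoints s n A := by
  have h1 : √(n : ℝ) ≠ 0 := (Real.sqrt_pos.2 (by exact_mod_cast hn)).ne'
  have h2 : √(m.choose s : ℝ) ≠ 0 :=
    (Real.sqrt_pos.2 (by exact_mod_cast Nat.choose_pos hm)).ne'
  rw [rescaledJoints, Real.sqrt_div (Nat.cast_nonneg _)]
  field_simp

theorem tendsto_jointMoment (hm : Tendsto m atTop atTop)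
    (hlim : Tendsto (fun n : ℕ => ((m n).choose s : ℝ) / (n : ℝ)) atTop (𝓝 β))
    (hi : ConditionI s P ν Z) {k : ℕ} (hk : ConditionII k s P ν Z) {j : ℕ} (hjk : j ≤ k) :
    Tendsto (fun n => jointMoment s j (P n)) atTop (𝓝 (√β ^ j * ∫ ω, Z ω ^ j ∂ν)) := by
  have h := tendsto_integral_pow_of_le hi (fun n A => rescaledJoints_nonneg n A)
    (fun n j => .of_finite) hk.1 hk.2.2 hjk
  refine ((hlim.sqrt.pow j).mul h).congr' ?_
  filter_upwards [eventually_gt_atTop 0, hm.eventually_ge_atTop s] with n hn hmn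
  rw [jointMoment, ← integral_const_mul]
  refine integral_congr_ae (.of_forall fun A => ?_)
  dsimp only
  rw [choose_card_eq_sqrt_mul hn hmn, mul_pow]

theorem uniformTail_of_conditionII (hm : Tendsto m atTop atTop)
    (hlim : Tendsto (fun n : ℕ => ((m n).choose s : ℝ) / (n : ℝ)) atTop (𝓝 β))
    (hi : ConditionI s P ν Z) {k : ℕ} (hk : ConditionII k s P ν Z) {j : ℕ} (hj : 1 ≤ j)
    (hjk : j ≤ k) : UniformTail s P j := by
  intro ε hε
  set C : ℝ := √β + 1 with hC
  have hC0 : 0 < C := by positivity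
  obtain ⟨K, hK⟩ := exists_eventually_tail_le hi (fun n A => rescaledJoints_nonneg n A)
    (fun n j => .of_finite) hk.1 hk.2.2 hj hjk (show 0 < ε / C ^ j by positivity)
  refine ⟨⌈C * K⌉₊, ?_⟩
  filter_upwards [hK, eventually_gt_atTop 0, hm.eventually_ge_atTop s,
    hlim.sqrt.eventually_lt_const (show √β < C by linarith)] with n e1 hn hmn hc
  have h1 : tailMoment s (P n) j ⌈C * K⌉₊ ≤ C ^ j * ∫ A,
      (if (K : ℝ) < rescaledJoints s n A then rescaledJoints s n A ^ j else 0)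
        ∂(attributeLaw (P n)) := by
    rw [tailMoment, ← integral_const_mul]
    refine integral_mono_attributeLaw (P n) fun A => ?_
    have hr := rescaledJoints_nonneg (s := s) n A
    have hY : (A.card.choose s : ℝ) ≤ C * rescaledJoints s n A := by
      rw [choose_card_eq_sqrt_mul hn hmn]
      exact mul_le_mul_of_nonneg_right hc.le hr
    split_ifs with ha hb hb
    · rw [← mul_pow]
      exact pow_le_pow_left₀ (by positivity) hY j
    · have h2 : C * K < (A.card.choose s : ℝ) := Nat.lt_of_ceil_lt ha
      exact absurd (lt_of_mul_lt_mul_left (h2.trans_le hY) hC0.le) hb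
    · positivity
    · simp
  refine h1.trans ?_
  rw [le_div_iff₀ (by positivity)] at e1
  linarith

theorem exists_eventually_le_truncMoment (hm : Tendsto m atTop atTop) (hβ : 0 < β)
    (hlim : Tendsto (fun n : ℕ => ((m n).choose s : ℝ) / (n : ℝ)) atTop (𝓝 β))
    (hi : ConditionI s P ν Z) {k : ℕ} (htop : ∫⁻ ω, ENNReal.ofReal (Z ω ^ k) ∂ν = ⊤) (R : ℝ) :
    ∃ K : ℕ, ∀ᶠ n in atTop, R ≤ truncMoment s (P n) k K := by
  have hX : ∀ n (A : Finset (Fin (m n))), 0 ≤ rescaledJoints s n A :=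
    fun n A => rescaledJoints_nonneg n A
  have hZ := ae_nonneg_of_tendstoInDistribution hi hX
  set c : ℝ := min (√β / 2) 1 with hc
  have hβ' : 0 < √β := Real.sqrt_pos.2 hβ
  have hc0 : 0 < c := lt_min (by positivity) one_pos
  obtain ⟨K, hK⟩ := exists_le_integral_min_pow hi.aemeasurable_limit hZ htop (R / c ^ k + 1)
  have h1 := tendsto_integral_min_pow hi hX (Nat.cast_nonneg K) k
  refine ⟨K, ?_⟩
  filter_upwards [h1.eventually_const_lt (show R / c ^ k < ∫ ω, min (Z ω) (K : ℝ) ^ k ∂ν by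
      linarith), eventually_gt_atTop 0, hm.eventually_ge_atTop s,
    hlim.sqrt.eventually_const_lt (show c < √β from
      (min_le_left _ _).trans_lt (half_lt_self hβ'))] with n e1 hn hmn hcn
  rw [div_lt_iff₀ (by positivity)] at e1
  refine e1.le.trans ?_
  rw [truncMoment, ← integral_mul_const]
  refine integral_mono_attributeLaw (P n) fun A => ?_
  rw [← mul_pow]
  have hr := hX n A
  refine pow_le_pow_left₀ (mul_nonneg (le_min hr (Nat.cast_nonneg K)) hc0.le) (le_min ?_ ?_) k
  · rw [choose_card_eq_sqrt_mul hn hmn, mul_comm]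
    exact mul_le_mul hcn.le (min_le_left _ _) (le_min hr (Nat.cast_nonneg K)) (Real.sqrt_nonneg _)
  · exact mul_le_of_le_one_right (Nat.cast_nonneg K) (min_le_right _ _) |>.trans' <|
      mul_le_mul_of_nonneg_right (min_le_right _ _) hc0.le

end Transfer

/-! ### Limits of the conditional degree moments -/

section DegreeLimits

variable {s : ℕ} {m : ℕ → ℕ} {P : ∀ n, PMF (Fin (m n + 1))} {β x y : ℝ}

theorem tendsto_sub_div_choose (hβ : 0 < β)
    (hlim : Tendsto (fun n : ℕ => ((m n).choose s : ℝ) / (n : ℝ)) atTop (𝓝 β)) (c : ℝ) :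
    Tendsto (fun n : ℕ => ((n : ℝ) - c) / ((m n).choose s : ℝ)) atTop (𝓝 β⁻¹) := by
  have h1 := (hlim.inv₀ hβ.ne').mul
    ((tendsto_const_nhds (x := (1 : ℝ))).sub (tendsto_const_div_atTop_nhds_zero_nat c))
  rw [sub_zero, mul_one] at h1
  refine h1.congr' ?_
  filter_upwards [eventually_gt_atTop 0] with n hn
  have : (n : ℝ) ≠ 0 := by exact_mod_cast hn.ne'
  rw [inv_div]
  field_simp

theorem tendsto_choose_mul_starProb_one (hs : 0 < s) (hm : Tendsto m atTop atTop)
    (h1 : UniformTail s P 1) (hx : Tendsto (fun n => jointMoment s 1 (P n)) atTop (𝓝 x)) :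
    Tendsto (fun n => ((m n).choose s : ℝ) * starProb s (P n) 1) atTop (𝓝 (x ^ 2)) := by
  have h := tendsto_choose_pow_mul_starProb hs hm (k := 0) h1 h1 hx hx
  simpa only [zero_add, pow_one, ← sq] using h

theorem eventually_starProb_one_pos (hs : 0 < s) (hm : Tendsto m atTop atTop)
    (h1 : UniformTail s P 1) (hx : Tendsto (fun n => jointMoment s 1 (P n)) atTop (𝓝 x))
    (hx0 : 0 < x) : ∀ᶠ n in atTop, 0 < starProb s (P n) 1 := by
  have hT := tendsto_choose_mul_starProb_one hs hm h1 hx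
  filter_upwards [hT.eventually_const_lt (show 0 < x ^ 2 by positivity)] with n hn
  exact pos_of_mul_pos_right hn (by positivity)

theorem tendsto_degMean (hs : 0 < s) (hm : Tendsto m atTop atTop) (hβ : 0 < β)
    (hlim : Tendsto (fun n : ℕ => ((m n).choose s : ℝ) / (n : ℝ)) atTop (𝓝 β))
    (h1 : UniformTail s P 1) (h2 : UniformTail s P 2)
    (hx : Tendsto (fun n => jointMoment s 1 (P n)) atTop (𝓝 x))
    (hy : Tendsto (fun n => jointMoment s 2 (P n)) atTop (𝓝 y)) (hx0 : 0 < x) :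
    Tendsto (fun n => degMean (graphLaw n (P n)) (intersectionGraph s)) atTop
      (𝓝 (1 + β⁻¹ * y)) := by
  have hT1 := tendsto_choose_mul_starProb_one hs hm h1 hx
  have hT2 : Tendsto (fun n => ((m n).choose s : ℝ) ^ 2 * starProb s (P n) 2) atTop
      (𝓝 (x ^ 2 * y)) := tendsto_choose_pow_mul_starProb hs hm (k := 1) h1 h2 hx hy
  have hx1 : x ^ 2 ≠ 0 := by positivity
  have h := (((tendsto_sub_div_choose hβ hlim 2).mul hT2).div hT1 hx1).const_add 1
  rw [show 1 + β⁻¹ * (x ^ 2 * y) / x ^ 2 = 1 + β⁻¹ * y by field_simp] at h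
  refine h.congr' ?_
  filter_upwards [eventually_starProb_one_pos hs hm h1 hx hx0, eventually_ge_atTop 2,
    hm.eventually_ge_atTop s] with n hp hn hmn
  have hM : ((m n).choose s : ℝ) ≠ 0 := by exact_mod_cast (Nat.choose_pos hmn).ne'
  rw [degMean_eq s (P n) hn, Pi.div_apply]
  field_simp

theorem tendsto_degProdMean (hs : 0 < s) (hm : Tendsto m atTop atTop) (hβ : 0 < β)
    (hlim : Tendsto (fun n : ℕ => ((m n).choose s : ℝ) / (n : ℝ)) atTop (𝓝 β))
    (h1 : UniformTail s P 1) (h2 : UniformTail s P 2)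
    (hx : Tendsto (fun n => jointMoment s 1 (P n)) atTop (𝓝 x))
    (hy : Tendsto (fun n => jointMoment s 2 (P n)) atTop (𝓝 y)) (hx0 : 0 < x) :
    Tendsto (fun n => degProdMean (graphLaw n (P n)) (intersectionGraph s)) atTop
      (𝓝 (1 + 2 * (β⁻¹ * y) + β⁻¹ * x + (β⁻¹ * y) ^ 2)) := by
  have hT1 := tendsto_choose_mul_starProb_one hs hm h1 hx
  have hT2 : Tendsto (fun n => ((m n).choose s : ℝ) ^ 2 * starProb s (P n) 2) atTop
      (𝓝 (x ^ 2 * y)) := tendsto_choose_pow_mul_starProb hs hm (k := 1) h1 h2 hx hy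
  have hTr := tendsto_choose_pow_mul_triangleProb hs hm h1 h2 hx
  have hTp := tendsto_choose_pow_mul_pathProb hs hm h1 h2 hx hy
  have hx1 : x ^ 2 ≠ 0 := by positivity
  have r2 := tendsto_sub_div_choose hβ hlim 2
  have r3 := tendsto_sub_div_choose hβ hlim 3
  have h := (((((r2.mul hT2).const_mul 2).add (r2.mul hTr)).add
    ((r2.mul r3).mul hTp)).div hT1 hx1).const_add 1
  rw [show 1 + (2 * (β⁻¹ * (x ^ 2 * y)) + β⁻¹ * x ^ 3 + β⁻¹ * β⁻¹ * (x ^ 2 * y ^ 2))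
    / x ^ 2 = 1 + 2 * (β⁻¹ * y) + β⁻¹ * x + (β⁻¹ * y) ^ 2 by field_simp; ring] at h
  refine h.congr' ?_
  filter_upwards [eventually_starProb_one_pos hs hm h1 hx hx0, eventually_ge_atTop 2,
    hm.eventually_ge_atTop s] with n hp hn hmn
  have hM : ((m n).choose s : ℝ) ≠ 0 := by exact_mod_cast (Nat.choose_pos hmn).ne'
  rw [degProdMean_eq s (P n) hn, Pi.div_apply]
  field_simp
  ring

theorem degSqMean_eq_rescaled {n m : ℕ} (P : PMF (Fin (m + 1))) (hn : 2 ≤ n) (hm : s ≤ m)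
    (hp : 0 < starProb s P 1) :
    degSqMean (graphLaw n P) (intersectionGraph s)
      = 1 + 3 * (((n : ℝ) - 2) / (m.choose s : ℝ) * ((m.choose s : ℝ) ^ 2 * starProb s P 2)
          / ((m.choose s : ℝ) * starProb s P 1))
        + ((n : ℝ) - 2) / (m.choose s : ℝ) * (((n : ℝ) - 3) / (m.choose s : ℝ))
          * ((m.choose s : ℝ) * starProb s P 1)⁻¹
          * ((m.choose s : ℝ) ^ 3 * starProb s P 3) := by
  have hM : (m.choose s : ℝ) ≠ 0 := by exact_mod_cast (Nat.choose_pos hm).ne'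
  rw [degSqMean_eq s P hn]
  field_simp

theorem tendsto_degSqMean (hs : 0 < s) (hm : Tendsto m atTop atTop) (hβ : 0 < β) {z : ℝ}
    (hlim : Tendsto (fun n : ℕ => ((m n).choose s : ℝ) / (n : ℝ)) atTop (𝓝 β))
    (h1 : UniformTail s P 1) (h2 : UniformTail s P 2) (h3 : UniformTail s P 3)
    (hx : Tendsto (fun n => jointMoment s 1 (P n)) atTop (𝓝 x))
    (hy : Tendsto (fun n => jointMoment s 2 (P n)) atTop (𝓝 y))
    (hz : Tendsto (fun n => jointMoment s 3 (P n)) atTop (𝓝 z)) (hx0 : 0 < x) :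
    Tendsto (fun n => degSqMean (graphLaw n (P n)) (intersectionGraph s)) atTop
      (𝓝 (1 + 3 * (β⁻¹ * y) + β⁻¹ ^ 2 * (x * z))) := by
  have hT1 := tendsto_choose_mul_starProb_one hs hm h1 hx
  have hT2 : Tendsto (fun n => ((m n).choose s : ℝ) ^ 2 * starProb s (P n) 2) atTop
      (𝓝 (x ^ 2 * y)) := tendsto_choose_pow_mul_starProb hs hm (k := 1) h1 h2 hx hy
  have hT3 : Tendsto (fun n => ((m n).choose s : ℝ) ^ 3 * starProb s (P n) 3) atTop
      (𝓝 (x ^ 3 * z)) := tendsto_choose_pow_mul_starProb hs hm (k := 2) h1 h3 hx hz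
  have hx1 : x ^ 2 ≠ 0 := by positivity
  have r2 := tendsto_sub_div_choose hβ hlim 2
  have r3 := tendsto_sub_div_choose hβ hlim 3
  have h := ((((r2.mul hT2).div hT1 hx1).const_mul 3).const_add 1).add
    (((r2.mul r3).mul (hT1.inv₀ hx1)).mul hT3)
  rw [show 1 + 3 * (β⁻¹ * (x ^ 2 * y) / x ^ 2)
    + β⁻¹ * β⁻¹ * (x ^ 2)⁻¹ * (x ^ 3 * z)
    = 1 + 3 * (β⁻¹ * y) + β⁻¹ ^ 2 * (x * z) by field_simp] at h
  refine h.congr' ?_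
  filter_upwards [eventually_starProb_one_pos hs hm h1 hx hx0, eventually_ge_atTop 2,
    hm.eventually_ge_atTop s] with n hp hn hmn
  rw [degSqMean_eq_rescaled (P n) hn hmn hp, Pi.div_apply]

theorem tendsto_degSqMean_atTop (hs : 0 < s) (hm : Tendsto m atTop atTop) (hβ : 0 < β)
    (hlim : Tendsto (fun n : ℕ => ((m n).choose s : ℝ) / (n : ℝ)) atTop (𝓝 β))
    (h1 : UniformTail s P 1) (h2 : UniformTail s P 2)
    (hx : Tendsto (fun n => jointMoment s 1 (P n)) atTop (𝓝 x))
    (hy : Tendsto (fun n => jointMoment s 2 (P n)) atTop (𝓝 y)) (hx0 : 0 < x)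
    (htr : ∀ R : ℝ, ∃ K : ℕ, ∀ᶠ n in atTop, R ≤ truncMoment s (P n) 3 K) :
    Tendsto (fun n => degSqMean (graphLaw n (P n)) (intersectionGraph s)) atTop atTop := by
  have hT1 := tendsto_choose_mul_starProb_one hs hm h1 hx
  have hT2 : Tendsto (fun n => ((m n).choose s : ℝ) ^ 2 * starProb s (P n) 2) atTop
      (𝓝 (x ^ 2 * y)) := tendsto_choose_pow_mul_starProb hs hm (k := 1) h1 h2 hx hy
  have hT3 := tendsto_choose_pow_mul_starProb_three_atTop hs hm h1 hx hx0 htr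
  have hx1 : x ^ 2 ≠ 0 := by positivity
  have r2 := tendsto_sub_div_choose hβ hlim 2
  have r3 := tendsto_sub_div_choose hβ hlim 3
  have h := ((((r2.mul hT2).div hT1 hx1).const_mul 3).const_add 1).add_atTop
    (((r2.mul r3).mul (hT1.inv₀ hx1)).pos_mul_atTop (by positivity) hT3)
  refine h.congr' ?_
  filter_upwards [eventually_starProb_one_pos hs hm h1 hx hx0, eventually_ge_atTop 2,
    hm.eventually_ge_atTop s] with n hp hn hmn
  rw [degSqMean_eq_rescaled (P n) hn hmn hp, Pi.div_apply]

end DegreeLimits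

/-- The two closed forms of the limit, in terms of the moments `z₁`, `z₂`, `z₃` of `Z`, agree. -/
theorem limit_eq_factMoment_form {β z₁ z₂ z₃ : ℝ} (hβ : 0 < β) (h1 : 0 < z₁) (h2 : 0 < z₂)
    (h3 : z₂ ^ 2 ≤ z₁ * z₃) :
    √β * z₁ / (β⁻¹ * (√β * z₁ * (√β ^ 3 * z₃) - (√β ^ 2 * z₂) ^ 2) + √β ^ 2 * z₂)
      = 1 / √β * ((z₁ ^ 1 * z₁) ^ (5 / 2 : ℝ) /
        (z₁ ^ 3 * z₃ * (z₁ ^ 1 * z₁) - (z₁ ^ 2 * z₂) ^ 2 + z₁ ^ 2 * z₂ * (z₁ ^ 1 * z₁))) := by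
  have hb : 0 < √β := Real.sqrt_pos.2 hβ
  have hbb : β = √β ^ 2 := (Real.sq_sqrt hβ.le).symm
  have h5 : (z₁ ^ 1 * z₁) ^ (5 / 2 : ℝ) = z₁ ^ 5 := by
    rw [pow_one, ← sq, ← Real.rpow_natCast z₁ 2, ← Real.rpow_mul h1.le, ← Real.rpow_natCast z₁ 5]
    norm_num
  rw [h5]
  have hD : 0 < z₁ * z₃ - z₂ ^ 2 + z₂ := by linarith
  have e1 : β⁻¹ * (√β * z₁ * (√β ^ 3 * z₃) - (√β ^ 2 * z₂) ^ 2) + √β ^ 2 * z₂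
      = √β ^ 2 * (z₁ * z₃ - z₂ ^ 2 + z₂) := by
    have : β⁻¹ * √β ^ 4 = √β ^ 2 := by
      rw [show √β ^ 4 = β * √β ^ 2 by nth_rewrite 2 [hbb]; ring]
      field_simp
    linear_combination (z₁ * z₃ - z₂ ^ 2) * this
  have e2 : z₁ ^ 3 * z₃ * (z₁ ^ 1 * z₁) - (z₁ ^ 2 * z₂) ^ 2 + z₁ ^ 2 * z₂ * (z₁ ^ 1 * z₁)
      = z₁ ^ 4 * (z₁ * z₃ - z₂ ^ 2 + z₂) := by ring
  rw [e1, e2]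
  field_simp

theorem theorem1 {Ω : Type*} [MeasurableSpace Ω] (ν : Measure Ω) [IsProbabilityMeasure ν]
    (Z : Ω → ℝ) (s : ℕ) (hs : 0 < s) (m : ℕ → ℕ) (hm : Tendsto m atTop atTop)
    (P : ∀ n, PMF (Fin (m n + 1))) (β : ℝ) (hβ : 0 < β)
    (hlim : Tendsto (fun n : ℕ => ((m n).choose s : ℝ) / (n : ℝ)) atTop (𝓝 β))
    (hi : ConditionI s P ν Z) :
    (ConditionII 3 s P ν Z →
      (∀ᶠ n in atTop, 0 < edgeProb (graphLaw n (P n)) (intersectionGraph s) ∧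
        0 < degSqMean (graphLaw n (P n)) (intersectionGraph s)
          - degMean (graphLaw n (P n)) (intersectionGraph s) ^ 2) ∧
      Tendsto (fun n : ℕ => rCoeff s n (P n) -
        jointMoment s 1 (P n) /
          (β⁻¹ * (jointMoment s 1 (P n) * jointMoment s 3 (P n) - jointMoment s 2 (P n) ^ 2)
            + jointMoment s 2 (P n))) atTop (𝓝 0) ∧
      (∀ i ∈ Finset.Icc 1 3, FactMomentFinite ν Z i) ∧
      Tendsto (fun n : ℕ => rCoeff s n (P n)) atTop
        (𝓝 (1 / √β * (factMoment ν Z 1 ^ (5 / 2 : ℝ) /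
          (factMoment ν Z 3 * factMoment ν Z 1 - factMoment ν Z 2 ^ 2
            + factMoment ν Z 2 * factMoment ν Z 1))))) ∧
    (ConditionII 2 s P ν Z → ∫⁻ ω, ENNReal.ofReal (Z ω ^ 3) ∂ν = ⊤ →
      (∀ᶠ n in atTop, 0 < edgeProb (graphLaw n (P n)) (intersectionGraph s) ∧
        0 < degSqMean (graphLaw n (P n)) (intersectionGraph s)
          - degMean (graphLaw n (P n)) (intersectionGraph s) ^ 2) ∧
      Tendsto (fun n : ℕ => rCoeff s n (P n)) atTop (𝓝 0)) := by
  have hZ : ∀ᵐ ω ∂ν, 0 ≤ Z ω :=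
    ae_nonneg_of_tendstoInDistribution hi fun n A => rescaledJoints_nonneg n A
  have hZm : AEMeasurable Z ν := hi.aemeasurable_limit
  have hb : 0 < √β := Real.sqrt_pos.2 hβ
  constructor
  · intro hk
    have iz : ∀ j ≤ 3, Integrable (fun ω => Z ω ^ j) ν := fun j hj =>
      integrable_pow_of_le hZm hZ hj hk.1
    have pz : ∀ j ≤ 3, 0 < ∫ ω, Z ω ^ j ∂ν := fun j hj =>
      integral_pow_pos hZ (by norm_num) (iz j hj) hk.2.1
    have hcs := sq_integral_sq_le hZm hZ hk.1 (pz 1 (by norm_num))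
    have ut : ∀ j, 1 ≤ j → j ≤ 3 → UniformTail s P j := fun j hj hj3 =>
      uniformTail_of_conditionII hm hlim hi hk hj hj3
    have hx := tendsto_jointMoment hm hlim hi hk (j := 1) (by norm_num)
    have hy := tendsto_jointMoment hm hlim hi hk (j := 2) (by norm_num)
    have hz := tendsto_jointMoment hm hlim hi hk (j := 3) (by norm_num)
    have z1 := pz 1 (by norm_num)
    have z2 := pz 2 (by norm_num)
    have hF := fun i (hi3 : i ≤ 3) => factMoment_eq hZm hZ (iz i hi3)
    have h1z : ∫ ω, Z ω ∂ν = ∫ ω, Z ω ^ 1 ∂ν := by simp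
    rw [(hF 1 (by norm_num)).2, (hF 2 (by norm_num)).2, (hF 3 le_rfl).2, h1z,
      ← limit_eq_factMoment_form hβ z1 z2 hcs]
    rw [pow_one] at hx
    set z₁ := ∫ ω, Z ω ^ 1 ∂ν
    set z₂ := ∫ ω, Z ω ^ 2 ∂ν
    set z₃ := ∫ ω, Z ω ^ 3 ∂ν
    have hx0 : 0 < √β * z₁ := by positivity
    have u1 := ut 1 le_rfl (by norm_num)
    have u2 := ut 2 (by norm_num) (by norm_num)
    have u3 := ut 3 (by norm_num) le_rfl
    have hb1 := tendsto_degMean hs hm hβ hlim u1 u2 hx hy hx0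
    have hg := tendsto_degProdMean hs hm hβ hlim u1 u2 hx hy hx0
    have hb2 := tendsto_degSqMean hs hm hβ hlim u1 u2 u3 hx hy hz hx0
    -- Cauchy-Schwarz makes the limit of the denominator positive
    have hDpos : 0 < β⁻¹ * (√β * z₁ * (√β ^ 3 * z₃) - (√β ^ 2 * z₂) ^ 2) + √β ^ 2 * z₂ := by
      have e : √β * z₁ * (√β ^ 3 * z₃) - (√β ^ 2 * z₂) ^ 2 = √β ^ 4 * (z₁ * z₃ - z₂ ^ 2) := by ring
      rw [e]
      have h0 : 0 ≤ z₁ * z₃ - z₂ ^ 2 := by linarith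
      positivity
    set D := β⁻¹ * (√β * z₁ * (√β ^ 3 * z₃) - (√β ^ 2 * z₂) ^ 2) + √β ^ 2 * z₂ with hD
    have hden := hb2.sub (hb1.pow 2)
    rw [show 1 + 3 * (β⁻¹ * (√β ^ 2 * z₂)) + β⁻¹ ^ 2 * (√β * z₁ * (√β ^ 3 * z₃))
        - (1 + β⁻¹ * (√β ^ 2 * z₂)) ^ 2 = β⁻¹ * D by rw [hD]; ring] at hden
    have hDpos' : 0 < β⁻¹ * D := by positivity
    have hr := (hg.sub (hb1.pow 2)).div hden hDpos'.ne'
    rw [show (1 + 2 * (β⁻¹ * (√β ^ 2 * z₂)) + β⁻¹ * (√β * z₁) + (β⁻¹ * (√β ^ 2 * z₂)) ^ 2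
        - (1 + β⁻¹ * (√β ^ 2 * z₂)) ^ 2) / (β⁻¹ * D) = √β * z₁ / D by field_simp; ring] at hr
    have hr' : Tendsto (fun n : ℕ => rCoeff s n (P n)) atTop (𝓝 (√β * z₁ / D)) := hr
    refine ⟨?_, ?_, ?_, hr'⟩
    · filter_upwards [eventually_starProb_one_pos hs hm u1 hx hx0, hden.eventually_const_lt hDpos',
        eventually_ge_atTop 2] with n hp hd hn
      exact ⟨by rwa [edgeProb_eq s (P n) hn], hd⟩
    · have ha := hx.div ((((hx.mul hz).sub (hy.pow 2)).const_mul β⁻¹).add hy) hDpos.ne'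
      have := hr'.sub ha
      rwa [sub_self] at this
    · intro i hi3
      exact (hF i (Finset.mem_Icc.1 hi3).2).1
  · intro hk htop
    have z1 : 0 < ∫ ω, Z ω ^ 1 ∂ν := integral_pow_pos hZ (by norm_num)
      (integrable_pow_of_le hZm hZ (by norm_num) hk.1) hk.2.1
    have hx := tendsto_jointMoment hm hlim hi hk (j := 1) (by norm_num)
    have hy := tendsto_jointMoment hm hlim hi hk (j := 2) le_rfl
    have hx0 : 0 < √β ^ 1 * ∫ ω, Z ω ^ 1 ∂ν := by positivity
    have u1 := uniformTail_of_conditionII hm hlim hi hk (j := 1) le_rfl (by norm_num)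
    have u2 := uniformTail_of_conditionII hm hlim hi hk (j := 2) (by norm_num) le_rfl
    have hb1 := tendsto_degMean hs hm hβ hlim u1 u2 hx hy hx0
    have hg := tendsto_degProdMean hs hm hβ hlim u1 u2 hx hy hx0
    have hb2 := tendsto_degSqMean_atTop hs hm hβ hlim u1 u2 hx hy hx0
      (exists_eventually_le_truncMoment hm hβ hlim hi htop)
    have hden := hb2.atTop_add (hb1.pow 2).neg
    simp only [← sub_eq_add_neg] at hden
    refine ⟨?_, (hg.sub (hb1.pow 2)).div_atTop hden⟩
    filter_upwards [eventually_starProb_one_pos hs hm u1 hx hx0, hden.eventually_gt_atTop 0,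
      eventually_ge_atTop 2] with n hp hd hn
    exact ⟨by rwa [edgeProb_eq s (P n) hn], hd⟩
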